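/- Let $(X,d_X)$ be a separable, locally compact metric space and $\mu$ a Borel regular measure on $X$ with $0<\mu(B(x,r))<\infty$ for every ball. Let $\mathcal M$ be the set of Borel measures $\nu\le\mu$ with compact support, $\mathcal X=\mathcal M\setminus\{0\}$ and $\|\nu\|=\nu(X)$. Fix a strictly increasing continuous $h:[0,\infty)\to[0,\infty)$ with $h(0)=\lim_{\varepsilon\to0^+}h(\varepsilon)/\varepsilon=0$, $h(a)+h(b)\le h(a+b)$ for $a,b\ge 0$, and $h(\varepsilon)\to\infty$ as $\varepsilon\to\infty$. For $\nu,\eta\in\mathcal M$ let $d_{\mathcal M}(\nu,\eta)$ be the infimum of the $\varepsilon>0$ for which there are at most countable families $\nu_i,\eta_i\in\mathcal M$ with $\nu=\sum_i\nu_i$, $\eta=\sum_i\eta_i$, $\sum_i\bigl|\|\nu_i\|-\|\eta_i\|\bigr|\le h(\varepsilon)$ and $\operatorname{diam}(\operatorname{supp}\nu_i\cup\operatorname{supp}\eta_i)\le\varepsilon$ for all $i$. A curve is a $1$-Lipschitz map $\nu:[0,b_\nu]\to(\mathcal X,d_{\mathcal M})$ with $b_\nu\ge 0$. For $f\in L^1_{\rm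 loc}(X)$ and $\eta\in\mathcal X$ put $F_f(\eta)=\|\eta\|^{-1}\int f\,d\eta$, and for $F:\mathcal X\to\mathbb R$ put $$r_F(\eta)=\lim_{\varepsilon\to0^+}\ \sup\Bigl\{\tfrac{|F(\nu(s))-F(\eta)|}{s}:\ \nu\text{ a curve},\ \nu(0)=\eta,\ 0<s<\min(\varepsilon,b_\nu)\Bigr\}\in[0,\infty].$$ We say that $f\in L^1_{\rm loc}(X)$ has the upper gradient $g_f=g\in L^1_{\rm loc}(X)$ if $r_{F_f}=F_g$ on $\mathcal X$. **Theorem.** Let $k\in L^1_{\rm loc}(X)$ have an upper gradient $g_k\in L^1_{\rm loc}(X)$ and let $c\in\mathbb R$. Then $k\wedge c=\min(k,c)$ and $k\vee c=\max(k,c)$ have upper gradients in $L^1_{\rm loc}(X)$; these are unique up to equality $\mu$-a.e., and $\mu$-a.e. $$g_{k\wedge c}=g_k\,\chi_{\{k<c\}},\qquad g_{k\vee c}=g_k\,\chi_{\{k>c\}}.$$ The same conclusion (existence, uniqueness and both formulas) holds if, throughout, $g_f$ is instead understood as the $\mu$-a.e. smallest $\mu$-a.e. nonnegative $g\in L^1_{\rm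 loc}(X)$ with $$\Bigl|\int f\,d\nu(s)-\int f\,d\nu(0)\Bigr|\le\int_0^s\Bigl(\int g\,d\nu(t)\Bigr)dt\qquad\text{for every curve }\nu\text{ and every }s\in[0,b_\nu].$$ -/

import Mathlib

open MeasureTheory Set Filter Topology
open scoped ENNReal

namespace MeasureCurves

/-- The gauge functions `h` on `[0, ∞)` used to price a change of total mass. -/
structure IsGauge (h : ℝ → ℝ) : Prop where
  strictMonoOn : StrictMonoOn h (Ici 0)
  continuousOn : ContinuousOn h (Ici 0)
  zero : h 0 = 0
  tendsto_div : Tendsto (fun ε => h ε / ε) (𝓝[>] 0) (𝓝 0)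
  superadditive : ∀ a b : ℝ, 0 ≤ a → 0 ≤ b → h a + h b ≤ h (a + b)
  tendsto_atTop : Tendsto h atTop atTop

section Space

variable {X : Type*} [MetricSpace X] [MeasurableSpace X]

/-- `𝓜`: the Borel measures with compact support that are dominated by `μ`. -/
def DomMeasures (μ : Measure X) : Set (Measure X) :=
  {ν | ν ≤ μ ∧ IsCompact ν.support}

/-- `𝓧 = 𝓜 \ {0}`. -/
abbrev NonzeroDom (μ : Measure X) : Type _ :=
  {ν : Measure X // ν ∈ DomMeasures μ ∧ ν ≠ 0}

/-- `(νs i, ηs i)` belongs to `Γ_{ε,δ}(ν, η)`. Finite families are padded by zero measures. -/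
structure IsDecomposition (μ : Measure X) (ε δ : ℝ) (ν η : Measure X)
    (νs ηs : ℕ → Measure X) : Prop where
  left_mem : ∀ i, νs i ∈ DomMeasures μ
  right_mem : ∀ i, ηs i ∈ DomMeasures μ
  left_sum : ν = Measure.sum νs
  right_sum : η = Measure.sum ηs
  mass_le : ∑' i, ENNReal.ofReal |(νs i).real univ - (ηs i).real univ| ≤ ENNReal.ofReal δ
  diam_le : ∀ i, Metric.diam ((νs i).support ∪ (ηs i).support) ≤ ε

/-- The distance `d_𝓜(ν, η) = inf {ε > 0 : Γ_{ε,h(ε)}(ν, η) ≠ ∅}` on `𝓜`. -/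
noncomputable def domDist (μ : Measure X) (h : ℝ → ℝ) (ν η : Measure X) : ℝ :=
  sInf {ε : ℝ | 0 < ε ∧ ∃ νs ηs : ℕ → Measure X, IsDecomposition μ ε (h ε) ν η νs ηs}

/-- The restriction of `ν` to `[0, b]` is a `1`-Lipschitz curve in `(𝓧, d_𝓜)`, that is, a rectifiable
curve subparametrized by arc length. Values of `ν` outside `[0, b]` play no role. -/
structure IsCurve (μ : Measure X) (h : ℝ → ℝ) (b : ℝ) (ν : ℝ → NonzeroDom μ) : Prop where
  nonneg : 0 ≤ b
  lipschitz : ∀ s t : ℝ, 0 ≤ s → s ≤ t → t ≤ b → domDist μ h (ν t).1 (ν s).1 ≤ t - s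

/-- The mean value function `F_f(η) = ‖η‖⁻¹ ∫ f dη` on `𝓧`. -/
noncomputable def meanValue (μ : Measure X) (f : X → ℝ) (η : NonzeroDom μ) : ℝ :=
  (η.1.real univ)⁻¹ * ∫ x, f x ∂η.1

/-- `r_F^ε(η)`: the supremum of `|F(ν(s)) - F(η)| / s` over all curves `ν : [0, b] → 𝓧` with
`ν(0) = η` and all `0 < s < min ε b`. -/
noncomputable def curveSlopeAt (μ : Measure X) (h : ℝ → ℝ) (F : NonzeroDom μ → ℝ) (ε : ℝ)
    (η : NonzeroDom μ) : ℝ≥0∞ :=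
  ⨆ (b : ℝ) (ν : ℝ → NonzeroDom μ) (_ : IsCurve μ h b ν) (_ : ν 0 = η)
    (s : ℝ) (_ : 0 < s ∧ s < min ε b), ENNReal.ofReal (|F (ν s) - F η| / s)

/-- `r_F(η) = lim_{ε → 0+} r_F^ε(η)`; as `r_F^ε` is nondecreasing in `ε`, the limit is the infimum
over `ε > 0`. -/
noncomputable def curveSlope (μ : Measure X) (h : ℝ → ℝ) (F : NonzeroDom μ → ℝ)
    (η : NonzeroDom μ) : ℝ≥0∞ :=
  ⨅ (ε : ℝ) (_ : 0 < ε), curveSlopeAt μ h F ε η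

/-- `g` is (a representative of) the upper gradient `g_f`: both functions are locally integrable and
`r_{F_f} = F_g` on `𝓧`. -/
structure IsUpperGradient (μ : Measure X) (h : ℝ → ℝ) (f g : X → ℝ) : Prop where
  locallyIntegrable : LocallyIntegrable f μ
  locallyIntegrable_grad : LocallyIntegrable g μ
  slope_eq : ∀ η : NonzeroDom μ,
    ((curveSlope μ h (meanValue μ f) η : ℝ≥0∞) : EReal) = ((meanValue μ g η : ℝ) : EReal)

/-- The nonnegative locally integrable `g` bounds the variation of `f` along every curve:
`|∫ f dν(s) - ∫ f dν(0)| ≤ ∫_0^s (∫ g dν(t)) dt`. -/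
structure BoundsAlongCurves (μ : Measure X) (h : ℝ → ℝ) (f g : X → ℝ) : Prop where
  locallyIntegrable : LocallyIntegrable f μ
  locallyIntegrable_grad : LocallyIntegrable g μ
  nonneg : 0 ≤ᵐ[μ] g
  bound : ∀ (b : ℝ) (ν : ℝ → NonzeroDom μ), IsCurve μ h b ν → ∀ s : ℝ, 0 ≤ s → s ≤ b →
    |(∫ x, f x ∂(ν s).1) - ∫ x, f x ∂(ν 0).1| ≤ ∫ t in (0 : ℝ)..s, ∫ x, g x ∂(ν t).1

/-- `g` is the `μ`-a.e. smallest function that bounds the variation of `f` along curves. -/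
structure IsSmallestBound (μ : Measure X) (h : ℝ → ℝ) (f g : X → ℝ) : Prop where
  bounds : BoundsAlongCurves μ h f g
  le : ∀ g' : X → ℝ, BoundsAlongCurves μ h f g' → g ≤ᵐ[μ] g'

end Space

end MeasureCurves

namespace MeasureCurves

/-! Since `h ε = o(ε)`, a curve cannot change its total mass, and cutting it into ever finer steps
makes the mass that is not transported negligible. So a curve of measures moves mass with at most
unit speed in the `∞`-Wasserstein distance (`IsCurve.mass_eq`, `IsCurve.close`). Conversely,
closeness in that distance bounds `domDist` (`domDist_le_of_close`). Couplings can be restricted to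
a part of a marginal, and compactness passes from finitely many times to all of them; hence every
nonzero `a₀ ≤ ν 0` extends to a curve of submeasures `a t ≤ ν t` of constant mass
(`IsCurve.exists_split`).

Take for `a₀` the part of `ν 0` on `{k < c}`. Bounding `min k c` by `k` on `a s` and by `c` on the
rest of `ν s` gives `∫ min k c dν s ≤ ∫ k da s + c (‖ν s‖ - ‖a s‖)`, with equality at `s = 0`. The
masses are constant, so `∫ min k c` initially grows no faster than `∫ k` along `a`, that is, at rate
at most the integral of `g` over `{k < c}`. A Dini derivative argument integrates this, and
reversing the curve gives the absolute value. Thus `g χ_{k<c}` bounds `min k c`; applying this to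
`-k` treats `max k c`.

Sharpness comes from `k = min k c + max k c - c`. For slopes, each truncation has slope at most its
candidate, while the sum of the two slopes is at least the slope of `k`, which dominates the sum of
the candidates; both inequalities are therefore equalities. For smallest bounds, a competitor for
one truncation plus the candidate for the other bounds `k`, hence is at least `g`, and this can be
read off on the relevant set. -/

theorem polishSpace_of_locallyCompact (X : Type*) [MetricSpace X] [LocallyCompactSpace X]
    [TopologicalSpace.SeparableSpace X] : PolishSpace X := by
  have hind : IsDenseInducing ((↑) : X → UniformSpace.Completion X) :=
    UniformSpace.Completion.isDenseInducing_coe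
  have hemb : IsEmbedding ((↑) : X → UniformSpace.Completion X) :=
    (UniformSpace.Completion.coe_isometry (α := X)).isEmbedding
  -- A compact neighbourhood stays closed in the completion and `X` is dense there, so `X` is open
  -- in a Polish space. Being Polish is what provides the disintegrations of couplings used later.
  have hopen : IsOpen (range ((↑) : X → UniformSpace.Completion X)) := by
    rw [isOpen_iff_mem_nhds]
    rintro _ ⟨x, rfl⟩
    obtain ⟨K, hK, hxK⟩ := exists_compact_mem_nhds x
    rw [hind.nhds_eq_comap] at hxK
    obtain ⟨V, hV, hVK⟩ := hxK
    obtain ⟨U, hUV, hU, hxU⟩ := mem_nhds_iff.1 hV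
    refine mem_of_superset (hU.mem_nhds hxU) ?_
    have hcl : IsClosed (((↑) : X → UniformSpace.Completion X) '' K) :=
      (hK.image hemb.continuous).isClosed
    intro y hy
    refine image_subset_range _ K ?_
    rw [← hcl.closure_eq]
    refine closure_mono ?_ (hind.dense.open_subset_closure_inter hU hy)
    rintro _ ⟨hz, z, rfl⟩
    exact ⟨z, hVK (hUV hz), rfl⟩
  have : SecondCountableTopology (UniformSpace.Completion X) :=
    UniformSpace.secondCountable_of_separable _
  have : PolishSpace (range ((↑) : X → UniformSpace.Completion X)) := hopen.polishSpace
  exact (hemb.toHomeomorph).isClosedEmbedding.polishSpace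

/-! ### Couplings and `∞`-Wasserstein closeness -/

section Couplings

variable {X : Type*} [MetricSpace X] [MeasurableSpace X]

/-- `a` and `b` are the marginals of a measure on `X × X` that gives mass at most `κ` to the pairs
of points at distance greater than `δ`. -/
def NearlyCoupled (δ : ℝ) (κ : ℝ≥0∞) (a b : Measure X) : Prop :=
  ∃ p : Measure (X × X), p.fst = a ∧ p.snd = b ∧ p {z | δ < dist z.1 z.2} ≤ κ

/-- The `∞`-Wasserstein distance of `a` and `b` is at most `δ`. -/
def Close (δ : ℝ) (a b : Measure X) : Prop :=
  ∀ δ', δ < δ' → NearlyCoupled δ' 0 a b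

theorem NearlyCoupled.mono {δ δ' : ℝ} {κ κ' : ℝ≥0∞} {a b : Measure X}
    (hab : NearlyCoupled δ κ a b) (hδ : δ ≤ δ') (hκ : κ ≤ κ') : NearlyCoupled δ' κ' a b := by
  obtain ⟨p, hp, hp', h⟩ := hab
  exact ⟨p, hp, hp', (measure_mono fun z hz => lt_of_le_of_lt hδ hz).trans (h.trans hκ)⟩

theorem Close.mono {δ δ' : ℝ} {a b : Measure X} (hab : Close δ a b) (hδ : δ ≤ δ') :
    Close δ' a b :=
  fun _ h => hab _ (hδ.trans_lt h)

theorem Close.of_forall_lt {δ : ℝ} {a b : Measure X} (hab : ∀ δ', δ < δ' → Close δ' a b) :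
    Close δ a b :=
  fun δ' h => hab ((δ + δ') / 2) (by linarith) δ' (by linarith)

theorem NearlyCoupled.univ_eq {δ : ℝ} {κ : ℝ≥0∞} {a b : Measure X}
    (hab : NearlyCoupled δ κ a b) : a univ = b univ := by
  obtain ⟨p, rfl, rfl, -⟩ := hab
  rw [Measure.fst_univ, Measure.snd_univ]

theorem Close.univ_eq {δ : ℝ} {a b : Measure X} (hab : Close δ a b) : a univ = b univ :=
  (hab (δ + 1) (by linarith)).univ_eq

open ProbabilityTheory

/-- A coupling can be restricted to a part of its first marginal. -/
theorem NearlyCoupled.split [StandardBorelSpace X] {δ : ℝ} {κ : ℝ≥0∞} {a b a' : Measure X}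
    [IsFiniteMeasure a] (hab : NearlyCoupled δ κ a b) (ha' : a' ≤ a) :
    ∃ b' ≤ b, NearlyCoupled δ κ a' b' := by
  obtain ⟨p, rfl, rfl, h⟩ := hab
  have : IsFiniteMeasure p := ⟨by rw [← Measure.fst_univ]; exact measure_lt_top _ _⟩
  have : IsFiniteMeasure a' := isFiniteMeasure_of_le _ ha'
  rcases isEmpty_or_nonempty X with hX | hX
  · exact ⟨p.snd, le_rfl, p, by rw [Measure.eq_zero_of_isEmpty p.fst,
      Measure.eq_zero_of_isEmpty a'], rfl, h⟩
  -- Moving `a'` by the conditional kernel of `p` gives a part of `p`, so far pairs receive no more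
  -- mass than before.
  have hle : a' ⊗ₘ p.condKernel ≤ p := by
    conv_rhs => rw [← p.disintegrate p.condKernel]
    refine Measure.le_iff.2 fun s hs => ?_
    rw [Measure.compProd_apply hs, Measure.compProd_apply hs]
    exact lintegral_mono' ha' le_rfl
  refine ⟨(a' ⊗ₘ p.condKernel).snd, Measure.map_mono hle measurable_snd, a' ⊗ₘ p.condKernel,
    Measure.fst_compProd _ _, rfl, (hle _).trans h⟩

variable [BorelSpace X] [SecondCountableTopology X]

theorem measurableSet_lt_dist (δ : ℝ) : MeasurableSet {z : X × X | δ < dist z.1 z.2} :=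
  measurableSet_lt measurable_const (measurable_fst.dist measurable_snd)

theorem NearlyCoupled.symm {δ : ℝ} {κ : ℝ≥0∞} {a b : Measure X}
    (hab : NearlyCoupled δ κ a b) : NearlyCoupled δ κ b a := by
  obtain ⟨p, hp, hp', h⟩ := hab
  refine ⟨p.map Prod.swap, ?_, ?_, ?_⟩
  · rw [Measure.fst_map_swap, hp']
  · rw [Measure.snd_map_swap, hp]
  · rw [Measure.map_apply measurable_swap (measurableSet_lt_dist δ)]
    simpa [dist_comm] using h

theorem Close.symm {δ : ℝ} {a b : Measure X} (hab : Close δ a b) : Close δ b a :=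
  fun δ' h => (hab δ' h).symm

theorem NearlyCoupled.refl {δ : ℝ} (hδ : 0 ≤ δ) (a : Measure X) : NearlyCoupled δ 0 a a := by
  have hd : Measurable fun x : X => (x, x) := measurable_id.prodMk measurable_id
  refine ⟨a.map fun x => (x, x), ?_, ?_, ?_⟩
  · rw [Measure.fst, Measure.map_map measurable_fst hd]
    exact Measure.map_id
  · rw [Measure.snd, Measure.map_map measurable_snd hd]
    exact Measure.map_id
  · rw [Measure.map_apply hd (measurableSet_lt_dist δ)]
    simp [not_lt.2 hδ]

theorem Close.refl {δ : ℝ} (hδ : 0 ≤ δ) (a : Measure X) : Close δ a a :=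
  fun _ h => NearlyCoupled.refl (hδ.trans h.le) a

/-- Gluing: disintegrate the second coupling over `b` and attach its kernel to the second coordinate
of the first. If the end points are farther apart than `δ + δ'`, one of the two steps is too long,
so the exceptional masses add. -/
theorem NearlyCoupled.trans [StandardBorelSpace X] {δ δ' : ℝ} {κ κ' : ℝ≥0∞} {a b c : Measure X}
    [IsFiniteMeasure a] (hab : NearlyCoupled δ κ a b) (hbc : NearlyCoupled δ' κ' b c) :
    NearlyCoupled (δ + δ') (κ + κ') a c := by
  have hac := hab.univ_eq.trans hbc.univ_eq
  obtain ⟨p, rfl, rfl, h⟩ := hab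
  obtain ⟨q, hq, rfl, h'⟩ := hbc
  have : IsFiniteMeasure p := ⟨by rw [← Measure.fst_univ]; exact measure_lt_top _ _⟩
  have : IsFiniteMeasure q := ⟨by rw [← Measure.fst_univ, hq]; exact measure_lt_top _ _⟩
  rcases isEmpty_or_nonempty X with hX | hX
  · exact ⟨p, rfl, by rw [Measure.snd, Measure.snd, Measure.eq_zero_of_isEmpty p,
      Measure.eq_zero_of_isEmpty q], by simp [Measure.eq_zero_of_isEmpty p]⟩
  set r : Measure ((X × X) × X) := p ⊗ₘ (Kernel.prodMkLeft X q.condKernel) with hr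
  have hr12 : r.map (fun w => w.1) = p := Measure.fst_compProd p _
  have hr23 : r.map (fun w => (w.1.2, w.2)) = q := by
    have hm : Measurable fun w : (X × X) × X => (w.1.2, w.2) := by fun_prop
    ext s hs
    rw [Measure.map_apply hm hs, hr, Measure.compProd_apply (hm hs)]
    conv_rhs => rw [← q.disintegrate q.condKernel, Measure.compProd_apply hs, hq, Measure.snd,
      lintegral_map (Kernel.measurable_kernel_prodMk_left hs) measurable_snd]
    rfl
  have hm : Measurable fun w : (X × X) × X => (w.1.1, w.2) := by fun_prop
  refine ⟨r.map (fun w => (w.1.1, w.2)), ?_, ?_, ?_⟩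
  · rw [Measure.fst, Measure.map_map measurable_fst hm, ← hr12, Measure.fst,
      Measure.map_map measurable_fst measurable_fst]
    rfl
  · rw [Measure.snd, Measure.map_map measurable_snd hm, ← hr23, Measure.snd,
      Measure.map_map measurable_snd (by fun_prop)]
    rfl
  · rw [Measure.map_apply hm (measurableSet_lt_dist _)]
    calc r ((fun w => (w.1.1, w.2)) ⁻¹' {z | δ + δ' < dist z.1 z.2})
        ≤ r ((fun w => w.1) ⁻¹' {z | δ < dist z.1 z.2} ∪
            (fun w => (w.1.2, w.2)) ⁻¹' {z | δ' < dist z.1 z.2}) := by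
          refine measure_mono fun w hw => ?_
          by_contra hcon
          simp only [mem_union, mem_preimage, mem_ofPred_eq, not_or, not_lt] at hcon hw
          linarith [dist_triangle w.1.1 w.1.2 w.2]
      _ ≤ _ := measure_union_le _ _
      _ ≤ κ + κ' := by
          refine add_le_add ?_ ?_
          · rw [← Measure.map_apply measurable_fst (measurableSet_lt_dist _), hr12]
            exact h
          · rw [← Measure.map_apply (by fun_prop) (measurableSet_lt_dist _), hr23]
            exact h'

theorem Close.trans [StandardBorelSpace X] {δ δ' : ℝ} {a b c : Measure X} [IsFiniteMeasure a]
    (hab : Close δ a b) (hbc : Close δ' b c) : Close (δ + δ') a c := by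
  intro d hd
  have := (hab (δ + (d - (δ + δ')) / 2) (by linarith)).trans
    (hbc (δ' + (d - (δ + δ')) / 2) (by linarith))
  exact this.mono (by linarith) (by simp)

end Couplings

/-! ### Compactness: setwise limits of measures and of couplings -/

/-- A Borel partition of a separable metric space into small pieces, finitely many of which cover
any given compact set. -/
theorem exists_measurable_small_fibers (X : Type*) [MetricSpace X] [MeasurableSpace X]
    [BorelSpace X] [TopologicalSpace.SeparableSpace X] {ε : ℝ} (hε : 0 < ε) :
    ∃ T : X → ℕ, Measurable T ∧ (∀ x y, T x = T y → dist x y ≤ ε) ∧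
      ∀ K : Set X, IsCompact K → ∃ N, ∀ x ∈ K, T x < N := by
  classical
  rcases isEmpty_or_nonempty X with hX | hX
  · exact ⟨fun _ => 0, measurable_const, fun x => isEmptyElim x,
      fun _ _ => ⟨0, fun x => isEmptyElim x⟩⟩
  have hex : ∀ x : X, ∃ n, dist x (TopologicalSpace.denseSeq X n) < ε / 2 := fun x => by
    obtain ⟨n, hn⟩ := (TopologicalSpace.denseRange_denseSeq X).exists_dist_lt x (half_pos hε)
    exact ⟨n, hn⟩
  -- The label of `x` is the first point of a dense sequence within `ε / 2`; a finite subcover of a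
  -- compact set bounds the labels on it.
  refine ⟨fun x => Nat.find (hex x), ?_, ?_, ?_⟩
  · refine measurable_find hex fun n => ?_
    exact measurableSet_lt (measurable_id.dist measurable_const) measurable_const
  · intro x y hxy
    have h1 := Nat.find_spec (hex x)
    have h2 := Nat.find_spec (hex y)
    simp only at hxy
    rw [hxy] at h1
    linarith [dist_triangle_right x y (TopologicalSpace.denseSeq X (Nat.find (hex y)))]
  · intro K hK
    obtain ⟨t, ht⟩ := hK.elim_finite_subcover
      (fun n => Metric.ball (TopologicalSpace.denseSeq X n) (ε / 2)) (fun _ => Metric.isOpen_ball)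
      (fun x _ => mem_iUnion.2 (hex x))
    refine ⟨t.sup id + 1, fun x hx => ?_⟩
    obtain ⟨n, hn, hxn⟩ := mem_iUnion₂.1 (ht hx)
    exact Nat.lt_succ_of_le ((Nat.find_le hxn).trans (Finset.le_sup (f := id) hn))

/-- Setwise limits along an ultrafilter of measures dominated by a fixed finite measure are
measures. -/
theorem exists_setwise_limit {α ι : Type*} [MeasurableSpace α] (U : Ultrafilter ι)
    (A : Measure α) [IsFiniteMeasure A] (a : ι → Measure α) (ha : ∀ i, a i ≤ A) :
    ∃ m ≤ A, ∀ s, MeasurableSet s → Tendsto (fun i => a i s) U (𝓝 (m s)) := by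
  have hlim : ∀ s : Set α, ∃ l : ℝ≥0∞, Tendsto (fun i => a i s) U (𝓝 l) := fun s => by
    obtain ⟨l, -, hl⟩ := isCompact_univ.ultrafilter_le_nhds (U.map fun i => a i s) (by simp)
    exact ⟨l, hl⟩
  choose F hF using hlim
  have hFA : ∀ s, F s ≤ A s := fun s => le_of_tendsto' (hF s) fun i => ha i s
  have hF0 : F ∅ = 0 := by simpa using hFA ∅
  have hmono : ∀ s t, s ⊆ t → F s ≤ F t := fun s t hst =>
    le_of_tendsto_of_tendsto' (hF s) (hF t) fun i => measure_mono hst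
  have hadd : ∀ s t, Disjoint s t → MeasurableSet t → F (s ∪ t) = F s + F t := fun s t hst ht => by
    refine tendsto_nhds_unique (hF _) ?_
    simp_rw [measure_union hst ht]
    exact (hF s).add (hF t)
  have hsum : ∀ f : ℕ → Set α, (∀ i, MeasurableSet (f i)) → Pairwise (Function.onFun Disjoint f) →
      F (⋃ i, f i) = ∑' i, F (f i) := by
    intro f hf hd
    have hfin : ∀ n, F (⋃ i ∈ Finset.range n, f i) = ∑ i ∈ Finset.range n, F (f i) := by
      intro n
      refine tendsto_nhds_unique (hF _) ?_
      simp_rw [measure_biUnion_finset (fun i _ j _ hij => hd hij) fun i _ => hf i]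
      exact tendsto_finsetSum _ fun i _ => hF _
    refine le_antisymm ?_ ?_
    -- Finite additivity survives the limit at once. Domination by the finite `A` makes the tails
    -- uniformly small, which upgrades it to countable additivity.
    · have htail := ENNReal.tendsto_sum_nat_add (fun i => A (f i))
        (by rw [← measure_iUnion hd hf]; exact measure_ne_top _ _)
      have hbound : ∀ n, F (⋃ i, f i) ≤ ∑' i, F (f i) + ∑' i, A (f (i + n)) := by
        intro n
        have hsplit : ⋃ i, f i = (⋃ i, f (i + n)) ∪ ⋃ i ∈ Finset.range n, f i := by
          ext x
          simp only [mem_iUnion, mem_union, Finset.mem_range, exists_prop]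
          constructor
          · rintro ⟨i, hi⟩
            rcases lt_or_ge i n with h | h
            · exact Or.inr ⟨i, h, hi⟩
            · exact Or.inl ⟨i - n, by rwa [Nat.sub_add_cancel h]⟩
          · rintro (⟨i, hi⟩ | ⟨i, -, hi⟩)
            exacts [⟨_, hi⟩, ⟨_, hi⟩]
        rw [hsplit, hadd _ _ ?_ (Finset.measurableSet_biUnion _ fun i _ => hf i), hfin, add_comm]
        · refine add_le_add (ENNReal.sum_le_tsum _) ((hFA _).trans (measure_iUnion_le _))
        · rw [disjoint_iUnion_left]
          intro i
          simp only [disjoint_iUnion_right, Finset.mem_range]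
          intro j hj
          exact hd (by omega)
      have := ge_of_tendsto' (tendsto_const_nhds.add htail) hbound
      simpa using this
    · rw [ENNReal.tsum_eq_iSup_nat]
      refine iSup_le fun n => ?_
      rw [← hfin]
      exact hmono _ _ (iUnion₂_subset fun i _ => subset_iUnion f i)
  refine ⟨Measure.ofMeasurable (fun s _ => F s) hF0 hsum, Measure.le_iff.2 fun s hs => ?_,
    fun s hs => ?_⟩
  · rw [Measure.ofMeasurable_apply s hs]; exact hFA s
  · rw [Measure.ofMeasurable_apply s hs]; exact hF s

section Limits
open ProbabilityTheory

theorem map_finset_sum {α β ι : Type*} [MeasurableSpace α] [MeasurableSpace β] {f : α → β}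
    (hf : Measurable f) (s : Finset ι) (m : ι → Measure α) :
    (∑ i ∈ s, m i).map f = ∑ i ∈ s, (m i).map f := by
  rw [← Measure.mapₗ_apply_of_measurable hf, map_sum]
  simp_rw [Measure.mapₗ_apply_of_measurable hf]

/-- A nonnegative matrix whose row and column sums are the masses that `a` and `b` give to the
fibers of `T` comes from a coupling of `a` and `b`. -/
theorem exists_coupling_of_matrix {X : Type*} [MeasurableSpace X] {a b : Measure X}
    [IsFiniteMeasure a] [IsFiniteMeasure b]
    {T : X → ℕ} (hT : Measurable T) {N : ℕ} (haN : a {x | ¬ T x < N} = 0)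
    (hbN : b {x | ¬ T x < N} = 0) (w : ℕ → ℕ → ℝ≥0∞)
    (hrow : ∀ m < N, ∑ n ∈ Finset.range N, w m n = a (T ⁻¹' {m}))
    (hcol : ∀ n < N, ∑ m ∈ Finset.range N, w m n = b (T ⁻¹' {n})) :
    ∃ p : Measure (X × X), p.fst = a ∧ p.snd = b ∧
      ∀ S : Set (X × X), (∀ x y, w (T x) (T y) ≠ 0 → (x, y) ∉ S) → p S = 0 := by
  have hTm : ∀ m, MeasurableSet (T ⁻¹' {m}) := fun m => hT (measurableSet_singleton m)
  have hwa : ∀ m < N, ∀ n < N, w m n ≠ 0 → a (T ⁻¹' {m}) ≠ 0 := fun m hm n hn h0 h => by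
    rw [← hrow m hm, Finset.sum_eq_zero_iff] at h
    exact h0 (h n (Finset.mem_range.2 hn))
  have hwb : ∀ m < N, ∀ n < N, w m n ≠ 0 → b (T ⁻¹' {n}) ≠ 0 := fun m hm n hn h0 h => by
    rw [← hcol n hn, Finset.sum_eq_zero_iff] at h
    exact h0 (h m (Finset.mem_range.2 hm))
  have hsum : ∀ c : Measure X, c {x | ¬ T x < N} = 0 →
      ∑ m ∈ Finset.range N, c.restrict (T ⁻¹' {m}) = c := by
    intro c hc
    ext s hs
    have hU : MeasurableSet {x | T x < N} := hT (measurableSet_Iio (a := N))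
    rw [Measure.finsetSum_apply]
    simp_rw [Measure.restrict_apply hs]
    rw [← measure_biUnion_finset]
    · have h0 : c (s \ {x | T x < N}) = 0 := measure_mono_null (fun x hx => hx.2) hc
      rw [← measure_inter_add_sdiff s hU, h0, add_zero]
      congr 1
      ext x
      simp
    · intro m _ n _ hmn
      refine disjoint_left.2 fun x hx hx' => hmn ?_
      rw [← hx.2, ← hx'.2]
    · exact fun m _ => hs.inter (hTm m)
  -- Mass `w m n` is spread over its cell as a product of normalized restrictions. If a fiber is
  -- null, the row or column sums force the weight to vanish, so normalizing there does no harm.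
  refine ⟨∑ m ∈ Finset.range N, ∑ n ∈ Finset.range N,
    w m n • (a[|T ⁻¹' {m}]).prod (b[|T ⁻¹' {n}]), ?_, ?_, fun S hS => ?_⟩
  · have : ∀ m ∈ Finset.range N, ∑ n ∈ Finset.range N,
        (w m n • (a[|T ⁻¹' {m}]).prod (b[|T ⁻¹' {n}])).fst = a.restrict (T ⁻¹' {m}) := by
      intro m hm
      have h1 : ∀ n ∈ Finset.range N, (w m n • (a[|T ⁻¹' {m}]).prod (b[|T ⁻¹' {n}])).fst =
          w m n • a[|T ⁻¹' {m}] := by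
        intro n hn
        by_cases h0 : w m n = 0
        · simp [h0, Measure.fst]
        · have := cond_isProbabilityMeasure
            (hwb m (Finset.mem_range.1 hm) n (Finset.mem_range.1 hn) h0)
          rw [Measure.fst, Measure.map_smul, ← Measure.fst, Measure.fst_prod]
      rw [Finset.sum_congr rfl h1, ← Finset.sum_smul, hrow m (Finset.mem_range.1 hm)]
      by_cases h0 : a (T ⁻¹' {m}) = 0
      · rw [h0, zero_smul, Measure.restrict_eq_zero.2 h0]
      · rw [ProbabilityTheory.cond, smul_smul, ENNReal.mul_inv_cancel h0 (measure_ne_top _ _),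
          one_smul]
    simp_rw [Measure.fst, map_finset_sum measurable_fst]
    exact (Finset.sum_congr rfl this).trans (hsum a haN)
  · have : ∀ n ∈ Finset.range N, ∑ m ∈ Finset.range N,
        (w m n • (a[|T ⁻¹' {m}]).prod (b[|T ⁻¹' {n}])).snd = b.restrict (T ⁻¹' {n}) := by
      intro n hn
      have h1 : ∀ m ∈ Finset.range N, (w m n • (a[|T ⁻¹' {m}]).prod (b[|T ⁻¹' {n}])).snd =
          w m n • b[|T ⁻¹' {n}] := by
        intro m hm
        by_cases h0 : w m n = 0
        · simp [h0, Measure.snd]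
        · have := cond_isProbabilityMeasure
            (hwa m (Finset.mem_range.1 hm) n (Finset.mem_range.1 hn) h0)
          rw [Measure.snd, Measure.map_smul, ← Measure.snd, Measure.snd_prod]
      rw [Finset.sum_congr rfl h1, ← Finset.sum_smul, hcol n (Finset.mem_range.1 hn)]
      by_cases h0 : b (T ⁻¹' {n}) = 0
      · rw [h0, zero_smul, Measure.restrict_eq_zero.2 h0]
      · rw [ProbabilityTheory.cond, smul_smul, ENNReal.mul_inv_cancel h0 (measure_ne_top _ _),
          one_smul]
    rw [Finset.sum_comm]
    simp_rw [Measure.snd, map_finset_sum measurable_snd]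
    exact (Finset.sum_congr rfl this).trans (hsum b hbN)
  · simp only [Measure.finsetSum_apply, Finset.sum_eq_zero_iff, Measure.smul_apply, smul_eq_mul,
      mul_eq_zero]
    intro m _ n _
    by_cases h0 : w m n = 0
    · exact Or.inl h0
    refine Or.inr (measure_mono_null (t := ((T ⁻¹' {m}) ×ˢ (T ⁻¹' {n}))ᶜ) ?_ ?_)
    · rintro ⟨x, y⟩ hxy ⟨h1, h2⟩
      refine hS x y ?_ hxy
      rw [show T x = m from h1, show T y = n from h2]
      exact h0
    · have hc : ∀ (c : Measure X) [IsFiniteMeasure c] (m : ℕ),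
          ProbabilityTheory.cond c (T ⁻¹' {m}) (T ⁻¹' {m})ᶜ = 0 := fun c _ m => by
        rw [cond_apply (hTm m), inter_compl_self, measure_empty, mul_zero]
      rw [compl_prod_eq_union]
      refine measure_union_null ?_ ?_
      · rw [Measure.prod_prod, hc, zero_mul]
      · rw [Measure.prod_prod, hc, mul_zero]

variable {X : Type*} [MetricSpace X] [MeasurableSpace X] [BorelSpace X]
  [SecondCountableTopology X]

/-- Closeness passes to setwise limits of almost couplings. -/
theorem Close.of_tendsto {ι : Type*} (l : Filter ι) [l.NeBot] {K : Set X} (hK : IsCompact K)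
    {δ : ι → ℝ} {κ : ι → ℝ≥0∞} {d : ℝ} {as bs : ι → Measure X} {a b : Measure X}
    [IsFiniteMeasure a] [IsFiniteMeasure b]
    (haK : ∀ i, as i Kᶜ = 0) (hbK : ∀ i, bs i Kᶜ = 0)
    (ha : ∀ s, MeasurableSet s → Tendsto (fun i => as i s) l (𝓝 (a s)))
    (hb : ∀ s, MeasurableSet s → Tendsto (fun i => bs i s) l (𝓝 (b s)))
    (hδ : Tendsto δ l (𝓝 d)) (hκ : Tendsto κ l (𝓝 0))
    (hC : ∀ᶠ i in l, NearlyCoupled (δ i) (κ i) (as i) (bs i)) : Close d a b := by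
  intro d' hd'
  set U := Ultrafilter.of l
  have hU : (U : Filter ι) ≤ l := Ultrafilter.of_le l
  -- One third of the gap `d' - d` goes to each of the two coordinates of a cell, and one to `δ i`
  -- exceeding `d`.
  obtain ⟨T, hT, hTd, hTK⟩ := exists_measurable_small_fibers X
    (show 0 < (d' - d) / 3 by linarith)
  obtain ⟨N, hN⟩ := hTK K hK
  have hTm : ∀ m, MeasurableSet (T ⁻¹' {m}) := fun m => hT (measurableSet_singleton m)
  have haK' : a Kᶜ = 0 := by
    have := ha Kᶜ hK.isClosed.measurableSet.compl
    simp_rw [haK] at this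
    exact tendsto_nhds_unique this tendsto_const_nhds
  have hbK' : b Kᶜ = 0 := by
    have := hb Kᶜ hK.isClosed.measurableSet.compl
    simp_rw [hbK] at this
    exact tendsto_nhds_unique this tendsto_const_nhds
  have hKN : {x | ¬ T x < N} ⊆ Kᶜ := fun x hx hxK => hx (hN x hxK)
  obtain ⟨p, hp⟩ : ∃ p : ι → Measure (X × X), ∀ᶠ i in l, (p i).fst = as i ∧ (p i).snd = bs i ∧
      p i {z | δ i < dist z.1 z.2} ≤ κ i := by
    classical
    refine ⟨fun i => if h : NearlyCoupled (δ i) (κ i) (as i) (bs i) then h.choose else 0, ?_⟩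
    filter_upwards [hC] with i hi
    simp only [dif_pos hi]
    exact hi.choose_spec
  -- The couplings `p i` are not dominated by a common measure, so only their cell masses are passed
  -- to the limit; a coupling of `a` and `b` is then rebuilt from these numbers.
  have hlim : ∀ m n, ∃ w : ℝ≥0∞,
      Tendsto (fun i => p i ((T ⁻¹' {m}) ×ˢ (T ⁻¹' {n}))) U (𝓝 w) := fun m n => by
    obtain ⟨w, -, hw⟩ := isCompact_univ.ultrafilter_le_nhds
      (U.map fun i => p i ((T ⁻¹' {m}) ×ˢ (T ⁻¹' {n}))) (by simp)
    exact ⟨w, hw⟩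
  choose w hw using hlim
  have hfib : ∀ s : Set X, ⋃ n ∈ Finset.range N, (s ×ˢ (T ⁻¹' {n})) = s ×ˢ {y | T y < N} := by
    intro s; ext z; simp
  have hfib' : ∀ s : Set X, ⋃ n ∈ Finset.range N, ((T ⁻¹' {n}) ×ˢ s) = {y | T y < N} ×ˢ s := by
    intro s; ext z; simp
  have hrow : ∀ m < N, ∑ n ∈ Finset.range N, w m n = a (T ⁻¹' {m}) := by
    intro m _
    refine tendsto_nhds_unique (tendsto_finsetSum _ fun n _ => hw m n)
      (((ha _ (hTm m)).mono_left hU).congr' ?_)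
    filter_upwards [hU hp] with i hi
    rw [← measure_biUnion_finset _ fun n _ => (hTm m).prod (hTm n), hfib, ← hi.1,
      Measure.fst_apply (hTm m)]
    · refine measure_congr (eventuallyEq_set.2 ?_)
      have h0 : p i (Prod.snd ⁻¹' Kᶜ) = 0 := by
        rw [← Measure.snd_apply hK.isClosed.measurableSet.compl, hi.2.1, hbK]
      filter_upwards [measure_eq_zero_iff_ae_notMem.1 h0] with z hz
      have : z.2 ∈ K := by simpa using hz
      simp [hN _ this]
    · intro n _ n' _ hnn
      refine disjoint_left.2 fun z hz hz' => hnn ?_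
      rw [← show T z.2 = n from hz.2, ← show T z.2 = n' from hz'.2]
  have hcol : ∀ n < N, ∑ m ∈ Finset.range N, w m n = b (T ⁻¹' {n}) := by
    intro n _
    refine tendsto_nhds_unique (tendsto_finsetSum _ fun m _ => hw m n)
      (((hb _ (hTm n)).mono_left hU).congr' ?_)
    filter_upwards [hU hp] with i hi
    rw [← measure_biUnion_finset _ fun m _ => (hTm m).prod (hTm n), hfib', ← hi.2.1,
      Measure.snd_apply (hTm n)]
    · refine measure_congr (eventuallyEq_set.2 ?_)
      have h0 : p i (Prod.fst ⁻¹' Kᶜ) = 0 := by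
        rw [← Measure.fst_apply hK.isClosed.measurableSet.compl, hi.1, haK]
      filter_upwards [measure_eq_zero_iff_ae_notMem.1 h0] with z hz
      have : z.1 ∈ K := by simpa using hz
      simp [hN _ this]
    · intro n _ n' _ hnn
      refine disjoint_left.2 fun z hz hz' => hnn ?_
      rw [← show T z.1 = n from hz.1, ← show T z.1 = n' from hz'.1]
  obtain ⟨q, hq1, hq2, hq⟩ := exists_coupling_of_matrix hT
    (measure_mono_null hKN haK') (measure_mono_null hKN hbK') w hrow hcol
  refine ⟨q, hq1, hq2, (hq _ fun x y hxy => ?_).le⟩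
  rw [mem_ofPred_eq, not_lt]
  by_contra hcon
  push Not at hcon
  -- All pairs in the cell of `(x, y)` are farther apart than `d + (d' - d) / 3`, hence eventually
  -- than `δ i`. The mass of the cell is then at most `κ i`, which tends to `0`.
  refine hxy (tendsto_nhds_unique (hw (T x) (T y)) ?_)
  refine tendsto_of_tendsto_of_tendsto_of_le_of_le' tendsto_const_nhds (hκ.mono_left hU)
    (Eventually.of_forall fun _ => zero_le) ?_
  filter_upwards [hU hp, hU (hδ.eventually_lt_const (show d < d + (d' - d) / 3 by linarith))]
    with i hi hi'
  refine (measure_mono ?_).trans hi.2.2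
  rintro ⟨x', y'⟩ ⟨hx', hy'⟩
  have h1 := hTd x x' (show T x = T x' from hx'.symm)
  have h2 := hTd y' y (show T y' = T y from hy')
  have h3 := dist_triangle4 x x' y' y
  simp only [mem_ofPred_eq] at hcon ⊢
  linarith

/-- A part of the first of two close measures is close to a part of the second. -/
theorem Close.split [StandardBorelSpace X] {δ : ℝ} {a b a' : Measure X} [IsFiniteMeasure a]
    {K : Set X} (hK : IsCompact K) (haK : a Kᶜ = 0) (hbK : b Kᶜ = 0)
    (hab : Close δ a b) (ha' : a' ≤ a) : ∃ b' ≤ b, Close δ a' b' := by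
  have hbfin : IsFiniteMeasure b := ⟨by rw [← hab.univ_eq]; exact measure_lt_top _ _⟩
  have : IsFiniteMeasure a' := isFiniteMeasure_of_le _ ha'
  have hsp : ∀ n : ℕ, ∃ b' ≤ b, NearlyCoupled (δ + 1 / ((n : ℝ) + 1)) 0 a' b' := fun n =>
    (hab _ (by have : (0 : ℝ) < 1 / ((n : ℝ) + 1) := by positivity
               linarith)).split ha'
  choose bs hbs hbs' using hsp
  obtain ⟨b', hb', hlim⟩ := exists_setwise_limit (Ultrafilter.of (atTop : Filter ℕ)) b bs hbs
  have : IsFiniteMeasure b' := isFiniteMeasure_of_le _ hb'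
  refine ⟨b', hb', Close.of_tendsto (Ultrafilter.of (atTop : Filter ℕ) : Filter ℕ) hK
    (as := fun _ => a') (fun _ => le_antisymm ((ha' _).trans haK.le) (zero_le))
    (fun n => le_antisymm ((hbs n _).trans hbK.le) (zero_le))
    (fun _ _ => tendsto_const_nhds) hlim (δ := fun n : ℕ => δ + 1 / ((n : ℝ) + 1))
    (κ := fun _ => 0) ?_ tendsto_const_nhds (Eventually.of_forall hbs')⟩
  have := (tendsto_one_div_add_atTop_nhds_zero_nat (𝕜 := ℝ)).const_add δ
  rw [add_zero] at this
  exact this.mono_left (Ultrafilter.of_le _)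

end Limits

/-! ### Comparison of `domDist` with couplings -/

section Distance

variable {X : Type*} [MetricSpace X] [MeasurableSpace X]

theorem mem_domMeasures_of_le {μ ν a : Measure X} (hν : ν ∈ DomMeasures μ) (ha : a ≤ ν) :
    a ∈ DomMeasures μ :=
  ⟨ha.trans hν.1, hν.2.of_isClosed_subset Measure.isClosed_support (Measure.support_mono ha)⟩

theorem zero_mem_domMeasures (μ : Measure X) : (0 : Measure X) ∈ DomMeasures μ :=
  ⟨Measure.zero_le μ, by simp⟩

theorem IsDecomposition.symm {μ : Measure X} {ε δ : ℝ} {ν η : Measure X} {νs ηs : ℕ → Measure X}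
    (hd : IsDecomposition μ ε δ ν η νs ηs) : IsDecomposition μ ε δ η ν ηs νs where
  left_mem := hd.right_mem
  right_mem := hd.left_mem
  left_sum := hd.right_sum
  right_sum := hd.left_sum
  mass_le := by simpa only [abs_sub_comm] using hd.mass_le
  diam_le i := by simpa only [union_comm] using hd.diam_le i

theorem domDist_comm (μ : Measure X) (h : ℝ → ℝ) (ν η : Measure X) :
    domDist μ h ν η = domDist μ h η ν := by
  unfold domDist
  congr 1
  ext ε
  constructor <;> rintro ⟨h0, νs, ηs, hd⟩ <;> exact ⟨h0, ηs, νs, hd.symm⟩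

theorem IsGauge.nonneg {h : ℝ → ℝ} (hh : IsGauge h) {ε : ℝ} (hε : 0 ≤ ε) : 0 ≤ h ε := by
  rw [← hh.zero]
  exact hh.strictMonoOn.monotoneOn self_mem_Ici hε hε

/-- The undivided pair is admissible once `ε` is large, because `h` is unbounded. This ensures that
`domDist` is a genuine infimum and not the default value `0` of `sInf ∅`. -/
theorem exists_isDecomposition {μ : Measure X} {h : ℝ → ℝ} (hh : IsGauge h) {ν η : Measure X}
    (hν : ν ∈ DomMeasures μ) (hη : η ∈ DomMeasures μ) :
    ∃ ε : ℝ, 0 < ε ∧ ∃ νs ηs : ℕ → Measure X, IsDecomposition μ ε (h ε) ν η νs ηs := by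
  obtain ⟨ε, h1, h2, h3⟩ := ((hh.tendsto_atTop.eventually_ge_atTop
    |ν.real univ - η.real univ|).and ((eventually_ge_atTop
      (Metric.diam (ν.support ∪ η.support))).and (eventually_gt_atTop 0))).exists
  have hs : ∀ a : Measure X, a = Measure.sum fun i : ℕ => if i = 0 then a else 0 := by
    intro a
    ext s hs
    rw [Measure.sum_apply _ hs, tsum_eq_single 0]
    · simp
    · intro i hi; simp [hi]
  refine ⟨ε, h3, fun i => if i = 0 then ν else 0, fun i => if i = 0 then η else 0,
    ?_, ?_, hs ν, hs η, ?_, ?_⟩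
  · intro i; split_ifs
    exacts [hν, zero_mem_domMeasures μ]
  · intro i; split_ifs
    exacts [hη, zero_mem_domMeasures μ]
  · rw [tsum_eq_single 0]
    · simpa using ENNReal.ofReal_le_ofReal h1
    · intro i hi; simp [hi]
  · intro i; split_ifs
    exacts [h2, by simpa using h3.le]

theorem exists_isDecomposition_of_domDist_lt {μ : Measure X} {h : ℝ → ℝ} (hh : IsGauge h)
    {ν η : Measure X} (hν : ν ∈ DomMeasures μ) (hη : η ∈ DomMeasures μ) {ε : ℝ}
    (hε : domDist μ h ν η < ε) :
    ∃ νs ηs : ℕ → Measure X, IsDecomposition μ ε (h ε) ν η νs ηs := by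
  obtain ⟨ε', ⟨h0, νs, ηs, hd⟩, hlt⟩ := exists_lt_of_csInf_lt (exists_isDecomposition hh hν hη) hε
  exact ⟨νs, ηs, hd.left_mem, hd.right_mem, hd.left_sum, hd.right_sum,
    hd.mass_le.trans (ENNReal.ofReal_le_ofReal
      (hh.strictMonoOn.monotoneOn h0.le (h0.trans hlt).le hlt.le)),
    fun i => (hd.diam_le i).trans hlt.le⟩

variable [SecondCountableTopology X]

theorem isFiniteMeasure_of_mem_domMeasures {μ ν : Measure X} [IsLocallyFiniteMeasure μ]
    (hν : ν ∈ DomMeasures μ) : IsFiniteMeasure ν := by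
  refine ⟨?_⟩
  rw [← union_compl_self ν.support]
  refine (measure_union_le _ _).trans_lt ?_
  rw [Measure.measure_compl_support, add_zero]
  exact (hν.1 _).trans_lt hν.2.measure_lt_top

theorem IsDecomposition.left_univ_le {μ : Measure X} [IsLocallyFiniteMeasure μ] {ε δ : ℝ}
    {ν η : Measure X} {νs ηs : ℕ → Measure X} (hd : IsDecomposition μ ε δ ν η νs ηs) :
    ν univ ≤ η univ + ENNReal.ofReal δ := by
  rw [hd.left_sum, hd.right_sum, Measure.sum_apply _ MeasurableSet.univ,
    Measure.sum_apply _ MeasurableSet.univ]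
  refine le_trans ?_ (add_le_add le_rfl hd.mass_le)
  rw [← ENNReal.tsum_add]
  refine ENNReal.tsum_le_tsum fun i => ?_
  have := isFiniteMeasure_of_mem_domMeasures (hd.left_mem i)
  have := isFiniteMeasure_of_mem_domMeasures (hd.right_mem i)
  rw [← ofReal_measureReal, ← ofReal_measureReal,
    ← ENNReal.ofReal_add measureReal_nonneg (abs_nonneg _)]
  exact ENNReal.ofReal_le_ofReal (by linarith [le_abs_self ((νs i).real univ - (ηs i).real univ)])

theorem IsDecomposition.abs_mass_sub_le {μ : Measure X} [IsLocallyFiniteMeasure μ] {ε δ : ℝ}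
    (hδ : 0 ≤ δ) {ν η : Measure X} (hν : ν ∈ DomMeasures μ) (hη : η ∈ DomMeasures μ)
    {νs ηs : ℕ → Measure X} (hd : IsDecomposition μ ε δ ν η νs ηs) :
    |ν.real univ - η.real univ| ≤ δ := by
  have := isFiniteMeasure_of_mem_domMeasures hν
  have := isFiniteMeasure_of_mem_domMeasures hη
  have h1 := hd.left_univ_le
  have h2 := hd.symm.left_univ_le
  rw [← ofReal_measureReal (μ := ν), ← ofReal_measureReal (μ := η),
    ← ENNReal.ofReal_add measureReal_nonneg hδ,
    ENNReal.ofReal_le_ofReal_iff (add_nonneg measureReal_nonneg hδ)] at h1 h2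
  rw [abs_le]
  constructor <;> linarith

/-- The product term is `min x y`: it is the mass of a product measure divided by the larger of its
factors' masses. -/
theorem inv_max_mul_mul_add_abs_ge (x y : ℝ) (hx : 0 ≤ x) (hy : 0 ≤ y) :
    ENNReal.ofReal x ≤ (max (ENNReal.ofReal x) (ENNReal.ofReal y))⁻¹ *
      (ENNReal.ofReal x * ENNReal.ofReal y) + ENNReal.ofReal |x - y| := by
  rcases le_total x y with h | h
  · rw [max_eq_right (ENNReal.ofReal_le_ofReal h)]
    rcases hy.eq_or_lt with rfl | hy'
    · simp [le_antisymm h hx]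
    · rw [mul_comm (ENNReal.ofReal x), ← mul_assoc, ENNReal.inv_mul_cancel (by simpa using hy')
        ENNReal.ofReal_ne_top, one_mul]
      exact le_self_add
  · rw [max_eq_left (ENNReal.ofReal_le_ofReal h)]
    rcases hx.eq_or_lt with rfl | hx'
    · simp
    · rw [← mul_assoc, ENNReal.inv_mul_cancel (by simpa using hx') ENNReal.ofReal_ne_top, one_mul,
        ← ENNReal.ofReal_add hy (abs_nonneg _)]
      exact ENNReal.ofReal_le_ofReal (by linarith [le_abs_self (x - y)])

variable [BorelSpace X]

/-- A decomposition of two measures of equal mass yields a coupling of them. -/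
theorem IsDecomposition.nearlyCoupled {μ : Measure X} [IsLocallyFiniteMeasure μ] {ε δ : ℝ}
    {ν η : Measure X} (hν : ν ∈ DomMeasures μ) (hη : η ∈ DomMeasures μ)
    {νs ηs : ℕ → Measure X} (hd : IsDecomposition μ ε δ ν η νs ηs) (hm : ν univ = η univ) :
    NearlyCoupled ε (ENNReal.ofReal δ) ν η := by
  have hfν := isFiniteMeasure_of_mem_domMeasures hν
  have hfη := isFiniteMeasure_of_mem_domMeasures hη
  have hfl := fun i => isFiniteMeasure_of_mem_domMeasures (hd.left_mem i)
  have hfr := fun i => isFiniteMeasure_of_mem_domMeasures (hd.right_mem i)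
  -- Dividing by the larger mass keeps both marginals of each scaled product below `νs i` and `ηs
  -- i`, and loses only the mass difference.
  set w : ℕ → ℝ≥0∞ := fun i => (max (νs i univ) (ηs i univ))⁻¹ with hw
  set q : Measure (X × X) := Measure.sum fun i => w i • (νs i).prod (ηs i) with hq
  have hq1 : q.fst ≤ ν := by
    rw [hq, Measure.fst, Measure.map_sum measurable_fst.aemeasurable, hd.left_sum]
    refine Measure.le_iff.2 fun s hs => ?_
    rw [Measure.sum_apply _ hs, Measure.sum_apply _ hs]
    refine ENNReal.tsum_le_tsum fun i => ?_
    rw [Measure.map_smul, Measure.map_fst_prod, Measure.smul_apply, Measure.smul_apply, smul_eq_mul,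
      smul_eq_mul, ← mul_assoc]
    refine mul_le_of_le_one_left zero_le ?_
    exact (mul_le_mul_right (le_max_right _ _) _).trans (ENNReal.inv_mul_le_one _)
  have hq2 : q.snd ≤ η := by
    rw [hq, Measure.snd, Measure.map_sum measurable_snd.aemeasurable, hd.right_sum]
    refine Measure.le_iff.2 fun s hs => ?_
    rw [Measure.sum_apply _ hs, Measure.sum_apply _ hs]
    refine ENNReal.tsum_le_tsum fun i => ?_
    rw [Measure.map_smul, Measure.map_snd_prod, Measure.smul_apply, Measure.smul_apply, smul_eq_mul,
      smul_eq_mul, ← mul_assoc]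
    refine mul_le_of_le_one_left zero_le ?_
    exact (mul_le_mul_right (le_max_left _ _) _).trans (ENNReal.inv_mul_le_one _)
  have hq0 : q {z | ε < dist z.1 z.2} = 0 := by
    rw [hq, Measure.sum_apply _ (measurableSet_lt_dist ε)]
    refine ENNReal.tsum_eq_zero.2 fun i => ?_
    rw [Measure.smul_apply, smul_eq_mul]
    refine mul_eq_zero_of_right _ (measure_mono_null
      (t := ((νs i).support ×ˢ (ηs i).support)ᶜ) ?_ ?_)
    · rintro ⟨x, y⟩ hxy ⟨hx, hy⟩
      refine not_lt.2 ?_ (show ε < dist x y from hxy)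
      exact (Metric.dist_le_diam_of_mem ((hd.left_mem i).2.union (hd.right_mem i).2).isBounded
        (Or.inl hx) (Or.inr hy)).trans (hd.diam_le i)
    · rw [compl_prod_eq_union]
      refine measure_union_null ?_ ?_
      · rw [Measure.prod_prod, Measure.measure_compl_support, zero_mul]
      · rw [Measure.prod_prod, Measure.measure_compl_support, mul_zero]
  have hqmass : ν univ ≤ q univ + ENNReal.ofReal δ := by
    rw [hd.left_sum, hq, Measure.sum_apply _ MeasurableSet.univ,
      Measure.sum_apply _ MeasurableSet.univ]
    refine le_trans ?_ (add_le_add le_rfl hd.mass_le)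
    rw [← ENNReal.tsum_add]
    refine ENNReal.tsum_le_tsum fun i => ?_
    have := inv_max_mul_mul_add_abs_ge ((νs i).real univ) ((ηs i).real univ)
      measureReal_nonneg measureReal_nonneg
    rw [ofReal_measureReal, ofReal_measureReal] at this
    rwa [Measure.smul_apply, ← univ_prod_univ, Measure.prod_prod, smul_eq_mul]
  have hf1 : IsFiniteMeasure q.fst := isFiniteMeasure_of_le _ hq1
  have hf2 : IsFiniteMeasure q.snd := isFiniteMeasure_of_le _ hq2
  have hqf : IsFiniteMeasure q := ⟨by rw [← Measure.fst_univ]; exact measure_lt_top _ _⟩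
  -- The uncoupled remainders have equal mass, at most `δ`, so they may be coupled arbitrarily, here
  -- by a normalized product.
  set a := ν - q.fst with ha
  set b := η - q.snd with hb
  have haν : a + q.fst = ν := Measure.sub_add_cancel_of_le hq1
  have hbη : b + q.snd = η := Measure.sub_add_cancel_of_le hq2
  have hfa : IsFiniteMeasure a :=
    isFiniteMeasure_of_le ν (by rw [← haν]; exact Measure.le_add_right le_rfl)
  have hfb : IsFiniteMeasure b :=
    isFiniteMeasure_of_le η (by rw [← hbη]; exact Measure.le_add_right le_rfl)
  have hau : a univ + q univ = ν univ := by
    rw [← haν, Measure.add_apply, Measure.fst_univ]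
  have hbu : b univ + q univ = η univ := by
    rw [← hbη, Measure.add_apply, Measure.snd_univ]
  have hab : a univ = b univ := by
    rw [← hm, ← hau] at hbu
    exact ((ENNReal.add_left_inj (measure_ne_top _ _)).1 hbu).symm
  have haδ : a univ ≤ ENNReal.ofReal δ := by
    rw [← hau, add_comm] at hqmass
    exact (ENNReal.add_le_add_iff_left (measure_ne_top _ _)).1 hqmass
  have hone : ∀ c : Measure X, c univ = a univ → ((a univ)⁻¹ * a univ) • c = c := by
    intro c hc
    by_cases h0 : a univ = 0
    · rw [h0] at hc
      rw [Measure.measure_univ_eq_zero.1 hc, smul_zero]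
    · rw [ENNReal.inv_mul_cancel h0 (measure_ne_top _ _), one_smul]
  refine ⟨(a univ)⁻¹ • a.prod b + q, ?_, ?_, ?_⟩
  · rw [Measure.fst, Measure.map_add _ _ measurable_fst, Measure.map_smul, Measure.map_fst_prod,
      smul_smul, ← hab, hone a rfl]
    exact haν
  · rw [Measure.snd, Measure.map_add _ _ measurable_snd, Measure.map_smul, Measure.map_snd_prod,
      smul_smul, hone b hab.symm]
    exact hbη
  · rw [Measure.add_apply, hq0, add_zero]
    refine (measure_mono (subset_univ _)).trans ?_
    rw [Measure.smul_apply, ← univ_prod_univ, Measure.prod_prod, smul_eq_mul, ← mul_assoc, ← hab]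
    exact (mul_le_of_le_one_left zero_le (ENNReal.inv_mul_le_one _)).trans haδ

/-- Cut a coupling along a grid of small cells. The two marginals of a piece have the same mass, so
the mass defect is zero. A charged cell contains a pair at distance at most `δ + κ / 3`, and moving
within the fibers costs at most another `2 κ / 3`. -/
theorem domDist_le_of_close {μ : Measure X} {h : ℝ → ℝ} {δ : ℝ} (hδ : 0 ≤ δ)
    {ν η : Measure X} (hν : ν ∈ DomMeasures μ) (hη : η ∈ DomMeasures μ) (hc : Close δ ν η) :
    domDist μ h ν η ≤ δ := by
  refine le_of_forall_pos_le_add fun κ hκ => csInf_le ⟨0, fun ε hε => hε.1.le⟩ ⟨by linarith, ?_⟩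
  obtain ⟨p, rfl, rfl, hp⟩ := hc (δ + κ / 3) (by linarith)
  obtain ⟨T, hT, hTd, -⟩ := exists_measurable_small_fibers X (show 0 < κ / 3 by linarith)
  have hTm : ∀ m, MeasurableSet (T ⁻¹' {m}) := fun m => hT (measurableSet_singleton m)
  set R : ℕ → Set (X × X) := fun k => (T ⁻¹' {k.unpair.1}) ×ˢ (T ⁻¹' {k.unpair.2}) with hR
  have hRm : ∀ k, MeasurableSet (R k) := fun k => (hTm _).prod (hTm _)
  have hRd : Pairwise (Function.onFun Disjoint R) := by
    intro k l hkl
    refine disjoint_left.2 fun z hz hz' => hkl ?_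
    rw [← Nat.pair_unpair k, ← Nat.pair_unpair l, ← show T z.1 = k.unpair.1 from hz.1,
      ← show T z.2 = k.unpair.2 from hz.2, ← show T z.1 = l.unpair.1 from hz'.1,
      ← show T z.2 = l.unpair.2 from hz'.2]
  have hRU : ⋃ k, R k = univ := by
    refine eq_univ_of_forall fun z => mem_iUnion.2 ⟨Nat.pair (T z.1) (T z.2), ?_⟩
    simp [hR]
  have hsum : p = Measure.sum fun k => p.restrict (R k) := by
    rw [← Measure.restrict_iUnion hRd hRm, hRU, Measure.restrict_univ]
  refine ⟨fun k => (p.restrict (R k)).fst, fun k => (p.restrict (R k)).snd,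
    fun k => mem_domMeasures_of_le hν (Measure.map_mono Measure.restrict_le_self measurable_fst),
    fun k => mem_domMeasures_of_le hη (Measure.map_mono Measure.restrict_le_self measurable_snd),
    ?_, ?_, ?_, ?_⟩
  · simp_rw [Measure.fst]
    rw [← Measure.map_sum measurable_fst.aemeasurable, ← hsum]
  · simp_rw [Measure.snd]
    rw [← Measure.map_sum measurable_snd.aemeasurable, ← hsum]
  · simp [Measure.real, Measure.fst_univ, Measure.snd_univ]
  · intro k
    have h0 : 0 ≤ δ + κ := by linarith
    by_cases hk : p (R k) = 0
    · simpa [Measure.restrict_eq_zero.2 hk, Measure.fst, Measure.snd] using h0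
    obtain ⟨z, hzR, hz⟩ : ∃ z ∈ R k, dist z.1 z.2 ≤ δ + κ / 3 := by
      by_contra hcon
      push Not at hcon
      exact hk (measure_mono_null (fun z hz => hcon z hz) (le_antisymm hp zero_le))
    have hpair : ∀ x ∈ T ⁻¹' {k.unpair.1} ∪ T ⁻¹' {k.unpair.2},
        ∀ y ∈ T ⁻¹' {k.unpair.1} ∪ T ⁻¹' {k.unpair.2}, dist x y ≤ δ + κ := by
      have hz1 : T z.1 = k.unpair.1 := hzR.1
      have hz2 : T z.2 = k.unpair.2 := hzR.2
      rintro x (hx | hx) y (hy | hy)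
      · exact (hTd x y ((show T x = _ from hx).trans (show T y = _ from hy).symm)).trans
          (by linarith)
      · have h1 := hTd x z.1 ((show T x = _ from hx).trans hz1.symm)
        have h2 := hTd z.2 y (hz2.trans (show T y = _ from hy).symm)
        linarith [dist_triangle4 x z.1 z.2 y]
      · have h1 := hTd x z.2 ((show T x = _ from hx).trans hz2.symm)
        have h2 := hTd z.1 y (hz1.trans (show T y = _ from hy).symm)
        linarith [dist_triangle4 x z.2 z.1 y, dist_comm z.1 z.2]
      · exact (hTd x y ((show T x = _ from hx).trans (show T y = _ from hy).symm)).trans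
          (by linarith)
    have hbdd : Bornology.IsBounded (T ⁻¹' {k.unpair.1} ∪ T ⁻¹' {k.unpair.2}) :=
      Metric.isBounded_iff.2 ⟨δ + κ, fun x hx y hy => hpair x hx y hy⟩
    refine le_trans (Metric.diam_mono ?_ hbdd.closure)
      ((Metric.diam_closure _).le.trans (Metric.diam_le_of_forall_dist_le h0 hpair))
    refine union_subset ?_ ?_
    · refine Measure.support_subset_of_isClosed isClosed_closure
        (mem_of_superset ?_ (subset_closure.trans (closure_mono subset_union_left)))
      rw [mem_ae_iff, Measure.fst_apply (hTm _).compl,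
        Measure.restrict_apply ((hTm _).compl.preimage measurable_fst)]
      refine measure_mono_null (t := ∅) ?_ measure_empty
      exact fun w hw => hw.1 hw.2.1
    · refine Measure.support_subset_of_isClosed isClosed_closure
        (mem_of_superset ?_ (subset_closure.trans (closure_mono subset_union_right)))
      rw [mem_ae_iff, Measure.snd_apply (hTm _).compl,
        Measure.restrict_apply ((hTm _).compl.preimage measurable_snd)]
      refine measure_mono_null (t := ∅) ?_ measure_empty
      exact fun w hw => hw.1 hw.2.2

end Distance

/-! ### Curves: constant mass, unit speed, following a submeasure -/

section Curves

variable {X : Type*} [MetricSpace X] [MeasurableSpace X] {μ : Measure X} {h : ℝ → ℝ} {b : ℝ}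
  {ν : ℝ → NonzeroDom μ}

theorem IsCurve.shift (hν : IsCurve μ h b ν) {t : ℝ} (ht : 0 ≤ t) (htb : t ≤ b) :
    IsCurve μ h (b - t) fun s => ν (t + s) where
  nonneg := by linarith
  lipschitz r s hr hrs hs := by
    have := hν.lipschitz (t + r) (t + s) (by linarith) (by linarith) (by linarith)
    linarith

theorem IsCurve.reverse (hν : IsCurve μ h b ν) {t : ℝ} (ht : 0 ≤ t) (htb : t ≤ b) :
    IsCurve μ h t fun s => ν (t - s) where
  nonneg := ht
  lipschitz r s hr hrs hs := by
    have := hν.lipschitz (t - s) (t - r) (by linarith) (by linarith) (by linarith)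
    rw [domDist_comm]
    linarith

variable [SecondCountableTopology X] [IsLocallyFiniteMeasure μ]

instance NonzeroDom.isFiniteMeasure (η : NonzeroDom μ) : IsFiniteMeasure η.1 :=
  isFiniteMeasure_of_mem_domMeasures η.2.1

theorem NonzeroDom.mass_pos (η : NonzeroDom μ) : 0 < η.1.real univ := by
  have := η.2.2
  refine lt_of_le_of_ne measureReal_nonneg fun h0 => this ?_
  rw [← Measure.measure_univ_eq_zero]
  exact (measureReal_eq_zero_iff (measure_ne_top _ _)).1 h0.symm

/-- The factor `2` makes the bound on the distance strict, since the infimum need not be attained.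
-/
theorem IsCurve.abs_mass_sub_le (hh : IsGauge h) (hν : IsCurve μ h b ν) {s t : ℝ} (hs : 0 ≤ s)
    (hst : s < t) (ht : t ≤ b) :
    |(ν t).1.real univ - (ν s).1.real univ| ≤ h (2 * (t - s)) := by
  have hlt : domDist μ h (ν t).1 (ν s).1 < 2 * (t - s) :=
    (hν.lipschitz s t hs hst.le ht).trans_lt (by linarith)
  obtain ⟨νs, ηs, hd⟩ := exists_isDecomposition_of_domDist_lt hh (ν t).2.1 (ν s).2.1 hlt
  exact hd.abs_mass_sub_le (hh.nonneg (by linarith)) (ν t).2.1 (ν s).2.1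

/-- The total mass is constant along a curve. -/
theorem IsCurve.mass_eq (hh : IsGauge h) (hν : IsCurve μ h b ν) {t : ℝ} (ht : t ∈ Icc 0 b) :
    (ν t).1.real univ = (ν 0).1.real univ := by
  have hscale : Tendsto (fun r : ℝ => 2 * r) (𝓝[>] 0) (𝓝[>] 0) := by
    refine tendsto_nhdsWithin_iff.2 ⟨?_, ?_⟩
    · have : Tendsto (fun r : ℝ => 2 * r) (𝓝 0) (𝓝 (2 * 0)) := tendsto_id.const_mul 2
      rw [mul_zero] at this
      exact this.mono_left nhdsWithin_le_nhds
    · filter_upwards [self_mem_nhdsWithin] with r hr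
      have : (0 : ℝ) < r := hr
      simpa using this
  -- As `h ε = o(ε)`, the mass has derivative zero everywhere on `[0, b]`.
  have hsmall : ∀ τ > 0, ∃ ρ > 0, ∀ s t, 0 ≤ s → s ≤ t → t ≤ b → t - s < ρ →
      |(ν t).1.real univ - (ν s).1.real univ| ≤ τ * (t - s) := by
    intro τ hτ
    have hev := (hh.tendsto_div.comp hscale).eventually_lt_const (half_pos hτ)
    rw [eventually_nhdsWithin_iff, Metric.eventually_nhds_iff] at hev
    obtain ⟨ρ, hρ, hev⟩ := hev
    refine ⟨ρ, hρ, fun s t hs hst ht hts => ?_⟩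
    rcases hst.eq_or_lt with rfl | hlt
    · simp
    refine (hν.abs_mass_sub_le hh hs hlt ht).trans ?_
    have h1 := hev (y := t - s) (by rw [Real.dist_0_eq_abs, abs_of_pos (by linarith)]; exact hts)
      (by simpa using hlt)
    simp only [Function.comp] at h1
    rw [div_lt_iff₀ (by linarith)] at h1
    linarith
  have hd : ∀ x ∈ Icc 0 b, HasDerivWithinAt (fun t => (ν t).1.real univ) 0 (Icc 0 b) x := by
    intro x hx
    rw [hasDerivWithinAt_iff_isLittleO, Asymptotics.isLittleO_iff]
    intro τ hτ
    obtain ⟨ρ, hρ, H⟩ := hsmall τ hτ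
    filter_upwards [self_mem_nhdsWithin, nhdsWithin_le_nhds (Metric.ball_mem_nhds x hρ)] with y hy hyx
    rw [Metric.mem_ball, Real.dist_eq, abs_lt] at hyx
    simp only [smul_zero, sub_zero, Real.norm_eq_abs]
    rcases le_total x y with hxy | hxy
    · rw [abs_of_nonneg (show 0 ≤ y - x by linarith)]
      exact H x y hx.1 hxy hy.2 (by linarith)
    · rw [abs_of_nonpos (show y - x ≤ 0 by linarith), abs_sub_comm]
      simpa using H y x hy.1 hxy hx.2 (by linarith)
  refine constant_of_has_deriv_right_zero (fun x hx => (hd x hx).continuousWithinAt)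
    (fun x hx => ?_) t ht
  exact (hd x ⟨hx.1, hx.2.le⟩).mono_of_mem_nhdsWithin (Icc_mem_nhdsGE_of_mem hx)

theorem IsCurve.univ_eq (hh : IsGauge h) (hν : IsCurve μ h b ν) {s t : ℝ} (hs : s ∈ Icc 0 b)
    (ht : t ∈ Icc 0 b) : (ν s).1 univ = (ν t).1 univ := by
  rw [← ofReal_measureReal, hν.mass_eq hh hs, ← hν.mass_eq hh ht, ofReal_measureReal]

variable [BorelSpace X] [StandardBorelSpace X]

/-- Along a curve the `∞`-Wasserstein distance grows at most with unit speed. -/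
theorem IsCurve.close (hh : IsGauge h) (hν : IsCurve μ h b ν) {s t : ℝ} (hs : 0 ≤ s)
    (hst : s ≤ t) (ht : t ≤ b) : Close (t - s) (ν s).1 (ν t).1 := by
  -- Use `n + 1` equal time steps. The surplus `1 / (n + 1)` makes each distance bound strict, also
  -- when `s = t`.
  set δ : ℕ → ℝ := fun n => t - s + 1 / ((n : ℝ) + 1) with hδ
  have hδ0 : ∀ n, 0 < δ n / ((n : ℝ) + 1) := fun n => by
    have : (0 : ℝ) < 1 / ((n : ℝ) + 1) := by positivity
    have : 0 < δ n := by simp only [hδ]; linarith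
    positivity
  have hδt : Tendsto δ atTop (𝓝 (t - s)) := by
    simpa only [add_zero] using
      (tendsto_one_div_add_atTop_nhds_zero_nat (𝕜 := ℝ)).const_add (t - s)
  have hstep : Tendsto (fun n => δ n / ((n : ℝ) + 1)) atTop (𝓝[>] 0) := by
    refine tendsto_nhdsWithin_iff.2 ⟨?_, Eventually.of_forall hδ0⟩
    have := hδt.mul (tendsto_one_div_add_atTop_nhds_zero_nat (𝕜 := ℝ))
    simpa [div_eq_mul_inv] using this
  have hchain : ∀ n i : ℕ, i ≤ n + 1 → NearlyCoupled (i * (δ n / ((n : ℝ) + 1)))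
      (i * ENNReal.ofReal (h (δ n / ((n : ℝ) + 1)))) (ν s).1
      (ν (s + i * ((t - s) / ((n : ℝ) + 1)))).1 := by
    intro n i
    induction i with
    | zero => intro _; simpa using NearlyCoupled.refl le_rfl (ν s).1
    | succ i ih =>
      intro hi
      have hn : (0 : ℝ) < (n : ℝ) + 1 := by positivity
      have hd0 : 0 ≤ (t - s) / ((n : ℝ) + 1) := div_nonneg (by linarith) hn.le
      have hi' : ((i : ℝ) + 1) * ((t - s) / ((n : ℝ) + 1)) ≤ t - s := by
        rw [mul_div_assoc', div_le_iff₀ hn, mul_comm]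
        exact mul_le_mul_of_nonneg_left (by exact_mod_cast hi) (by linarith)
      have h1 : 0 ≤ (i : ℝ) * ((t - s) / ((n : ℝ) + 1)) := by positivity
      have hlt : domDist μ h (ν (s + (i + 1 : ℕ) * ((t - s) / ((n : ℝ) + 1)))).1
          (ν (s + i * ((t - s) / ((n : ℝ) + 1)))).1 < δ n / ((n : ℝ) + 1) := by
        refine (hν.lipschitz _ _ (by linarith) (by push_cast; linarith)
          (by push_cast; linarith)).trans_lt ?_
        have : (t - s) / ((n : ℝ) + 1) < δ n / ((n : ℝ) + 1) := by
          refine div_lt_div_of_pos_right ?_ hn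
          have : (0 : ℝ) < 1 / ((n : ℝ) + 1) := by positivity
          simp only [hδ]; linarith
        push_cast
        linarith
      obtain ⟨νs, ηs, hd⟩ := exists_isDecomposition_of_domDist_lt hh (ν _).2.1 (ν _).2.1 hlt
      have hc := (hd.nearlyCoupled (ν _).2.1 (ν _).2.1
        (hν.univ_eq hh ⟨by push_cast; linarith, by push_cast; linarith⟩
          ⟨by linarith, by linarith⟩)).symm
      refine ((ih (by omega)).trans hc).mono (le_of_eq ?_) (le_of_eq ?_)
      · push_cast; ring
      · push_cast; ring
  have hK := (ν s).2.1.2.union (ν t).2.1.2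
  refine Close.of_tendsto atTop hK (δ := δ)
    (κ := fun n => ((n + 1 : ℕ) : ℝ≥0∞) * ENNReal.ofReal (h (δ n / ((n : ℝ) + 1))))
    (as := fun _ => (ν s).1) (bs := fun _ => (ν t).1) (fun _ => ?_) (fun _ => ?_)
    (fun _ _ => tendsto_const_nhds) (fun _ _ => tendsto_const_nhds) hδt ?_
    (Eventually.of_forall fun n => ?_)
  · exact measure_mono_null (compl_subset_compl.2 subset_union_left) Measure.measure_compl_support
  · exact measure_mono_null (compl_subset_compl.2 subset_union_right) Measure.measure_compl_support
  -- The total exceptional mass `(n + 1) h(δ n / (n + 1))` is `δ n` times a quotient `h ε / ε` with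
  -- `ε → 0`.
  · have := hδt.mul (hh.tendsto_div.comp hstep)
    rw [mul_zero] at this
    have := ENNReal.tendsto_ofReal this
    rw [ENNReal.ofReal_zero] at this
    refine this.congr fun n => ?_
    have hn : (0 : ℝ) < (n : ℝ) + 1 := by positivity
    rw [← ENNReal.ofReal_natCast, ← ENNReal.ofReal_mul (by positivity)]
    congr 1
    have : δ n ≠ 0 := fun h0 => by have := hδ0 n; rw [h0, zero_div] at this; exact lt_irrefl _ this
    simp only [Function.comp]
    push_cast
    field_simp
  · have hn : (0 : ℝ) < (n : ℝ) + 1 := by positivity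
    have := hchain n (n + 1) le_rfl
    have e1 : ((n + 1 : ℕ) : ℝ) * (δ n / ((n : ℝ) + 1)) = δ n := by push_cast; field_simp
    have e2 : s + ((n + 1 : ℕ) : ℝ) * ((t - s) / ((n : ℝ) + 1)) = t := by
      push_cast; field_simp; ring
    rwa [e1, e2] at this

/-- Along finitely many times, a part of the initial measure can be followed. -/
theorem IsCurve.exists_split_finset (hh : IsGauge h) (hν : IsCurve μ h b ν) {a₀ : Measure X}
    (ha₀ : a₀ ≤ (ν 0).1) (F : Finset ℝ) (hF : ∀ t ∈ F, 0 < t ∧ t ≤ b) :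
    ∃ a : ℝ → Measure X, (∀ t, a t ≤ (ν t).1) ∧ a 0 = a₀ ∧
      ∀ s ∈ insert 0 F, ∀ t ∈ insert 0 F, s ≤ t → Close (t - s) (a s) (a t) := by
  induction F using Finset.induction_on_max with
  | empty =>
    refine ⟨fun t => if t = 0 then a₀ else 0, fun t => ?_, if_pos rfl, ?_⟩
    · by_cases ht : t = 0
      · simpa [ht] using ha₀
      · simpa [ht] using Measure.zero_le _
    · intro s hs t ht _
      simp only [insert_empty_eq, Finset.mem_singleton] at hs ht
      subst hs ht
      exact Close.refl (by simp) _
  | insert x F hx ih =>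
    obtain ⟨a, ha, ha0, hac⟩ := ih fun t ht => hF t (Finset.mem_insert_of_mem ht)
    have hx0 := hF x (Finset.mem_insert_self _ _)
    have hlt : ∀ s ∈ insert 0 F, s < x := by
      intro s hs
      rcases Finset.mem_insert.1 hs with rfl | hs
      exacts [hx0.1, hx s hs]
    have hnonneg : ∀ s ∈ insert 0 F, 0 ≤ s := by
      intro s hs
      rcases Finset.mem_insert.1 hs with rfl | hs
      exacts [le_rfl, (hF s (Finset.mem_insert_of_mem hs)).1.le]
    -- It suffices to split between the last earlier time and `x`: for any `s ≤ m` the lengths `m -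
    -- s` and `x - m` add up to exactly `x - s`.
    set m := (insert 0 F).max' (Finset.insert_nonempty _ _) with hm
    have hmF : m ∈ insert 0 F := Finset.max'_mem _ _
    have hK := (ν m).2.1.2.union (ν x).2.1.2
    obtain ⟨a', ha', hca'⟩ := (hν.close hh (hnonneg m hmF) (hlt m hmF).le hx0.2).split hK
      (measure_mono_null (compl_subset_compl.2 subset_union_left) Measure.measure_compl_support)
      (measure_mono_null (compl_subset_compl.2 subset_union_right) Measure.measure_compl_support)
      (ha m)
    have hup : ∀ s ∈ insert 0 F, Function.update a x a' s = a s := fun s hs =>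
      Function.update_of_ne (hlt s hs).ne _ _
    have hins : insert 0 (insert x F) = insert x (insert 0 F) := Finset.insert_comm _ _ _
    refine ⟨Function.update a x a', fun t => ?_, ?_, ?_⟩
    · by_cases ht : t = x
      · subst ht; simpa using ha'
      · simpa [ht] using ha t
    · rw [hup 0 (Finset.mem_insert_self _ _), ha0]
    · rw [hins]
      intro s hs t ht hst
      rcases Finset.mem_insert.1 ht with rfl | ht'
      · rcases Finset.mem_insert.1 hs with rfl | hs'
        · exact Close.refl (by simp) _
        · rw [hup s hs', Function.update_self]
          have : IsFiniteMeasure (a s) := isFiniteMeasure_of_le _ (ha s)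
          exact ((hac s hs' m hmF (Finset.le_max' _ _ hs')).trans hca').mono (by linarith)
      · rcases Finset.mem_insert.1 hs with rfl | hs'
        · exact absurd hst (not_le.2 (hlt t ht'))
        · rw [hup s hs', hup t ht']
          exact hac s hs' t ht' hst

/-- A part of the initial measure of a curve can be followed along a curve of submeasures. -/
theorem IsCurve.exists_split (hh : IsGauge h) (hν : IsCurve μ h b ν) {a₀ : Measure X}
    (ha₀ : a₀ ≤ (ν 0).1) (hne : a₀ ≠ 0) :
    ∃ a : ℝ → NonzeroDom μ, IsCurve μ h b a ∧ (a 0).1 = a₀ ∧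
      (∀ t, (a t).1 univ = a₀ univ) ∧ ∀ t ∈ Icc 0 b, (a t).1 ≤ (ν t).1 := by
  classical
  choose A hA hA0 hAc using fun F : Finset ℝ => hν.exists_split_finset hh ha₀
    (F.filter fun t => 0 < t ∧ t ≤ b) (fun t ht => (Finset.mem_filter.1 ht).2)
  -- Finite sets of times are directed by inclusion, so any two given times eventually belong to
  -- `F`. The limit exists at every `t` because `A F t ≤ (ν t).1`.
  set U := Ultrafilter.of (atTop : Filter (Finset ℝ)) with hU
  choose a ha hlim using fun t : ℝ => exists_setwise_limit U (ν t).1 (fun F => A F t)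
    (fun F => hA F t)
  have hfin : ∀ t, IsFiniteMeasure (a t) := fun t => isFiniteMeasure_of_le _ (ha t)
  have ha0 : a 0 = a₀ := by
    ext s hs
    have := hlim 0 s hs
    simp_rw [hA0] at this
    exact tendsto_nhds_unique this tendsto_const_nhds
  have hmem : ∀ t ∈ Icc 0 b, ∀ᶠ F : Finset ℝ in (U : Filter (Finset ℝ)),
      t ∈ insert 0 (F.filter fun t => 0 < t ∧ t ≤ b) := by
    intro t ht
    refine Ultrafilter.of_le _ ?_
    filter_upwards [eventually_ge_atTop {t}] with F hF
    rcases ht.1.eq_or_lt with rfl | h0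
    · exact Finset.mem_insert_self _ _
    · exact Finset.mem_insert_of_mem
        (Finset.mem_filter.2 ⟨hF (Finset.mem_singleton_self t), h0, ht.2⟩)
  have hclose : ∀ s ∈ Icc 0 b, ∀ t ∈ Icc 0 b, s ≤ t → Close (t - s) (a s) (a t) := by
    intro s hs t ht hst
    refine Close.of_forall_lt fun δ' hδ' => ?_
    refine Close.of_tendsto (U : Filter (Finset ℝ)) ((ν s).2.1.2.union (ν t).2.1.2)
      (as := fun F => A F s) (bs := fun F => A F t) (fun F => ?_) (fun F => ?_) (hlim s) (hlim t)
      (δ := fun _ => δ') (κ := fun _ => 0) tendsto_const_nhds tendsto_const_nhds ?_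
    · exact le_antisymm ((hA F s _).trans (measure_mono_null
        (compl_subset_compl.2 subset_union_left) Measure.measure_compl_support).le) zero_le
    · exact le_antisymm ((hA F t _).trans (measure_mono_null
        (compl_subset_compl.2 subset_union_right) Measure.measure_compl_support).le) zero_le
    · filter_upwards [hmem s hs, hmem t ht] with F hsF htF
      exact hAc F s hsF t htF hst δ' hδ'
  have hmass : ∀ t ∈ Icc 0 b, a t univ = a₀ univ := fun t ht => by
    rw [← ha0]
    exact ((hclose 0 ⟨le_rfl, hν.nonneg⟩ t ht ht.1).univ_eq).symm
  have hdom : ∀ t, a t ∈ DomMeasures μ := fun t => mem_domMeasures_of_le (ν t).2.1 (ha t)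
  have hne' : ∀ t ∈ Icc 0 b, a t ≠ 0 := fun t ht h0 => by
    have := hmass t ht
    rw [h0, Measure.coe_zero, Pi.zero_apply] at this
    exact hne (Measure.measure_univ_eq_zero.1 this.symm)
  have h0b : (0 : ℝ) ∈ Icc 0 b := ⟨le_rfl, hν.nonneg⟩
  -- Outside `[0, b]` the limit could vanish, so `a 0` is substituted there.
  have hex : ∀ t, ∃ e : NonzeroDom μ, e.1 univ = a₀ univ ∧ (t ∈ Icc 0 b → e.1 = a t) := by
    intro t
    by_cases ht : t ∈ Icc 0 b
    · exact ⟨⟨a t, hdom t, hne' t ht⟩, hmass t ht, fun _ => rfl⟩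
    · exact ⟨⟨a 0, hdom 0, hne' 0 h0b⟩, hmass 0 h0b, fun h => absurd h ht⟩
  choose e hemass he using hex
  refine ⟨e, ⟨hν.nonneg, fun s t hs hst ht => ?_⟩, (he 0 h0b).trans ha0, hemass,
    fun t ht => (he t ht).trans_le (ha t)⟩
  have hsb : s ∈ Icc 0 b := ⟨hs, hst.trans ht⟩
  have htb : t ∈ Icc 0 b := ⟨hs.trans hst, ht⟩
  rw [he s hsb, he t htb, domDist_comm]
  exact domDist_le_of_close (by linarith) (hdom s) (hdom t) (hclose s hsb t htb hst)

end Curves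

/-! ### Continuity of integrals along curves -/

theorem le_restrict_of_null_compl {α : Type*} [MeasurableSpace α] {μ ν : Measure α} (hν : ν ≤ μ) {K : Set α} (hK : ν Kᶜ = 0) :
    ν ≤ μ.restrict K := by
  have : ν.restrict K = ν := Measure.restrict_eq_self_of_ae_mem (mem_ae_iff.2 hK)
  rw [← this]
  exact Measure.restrict_mono le_rfl hν

section Integrals

variable {X : Type*} [MetricSpace X] [MeasurableSpace X] {μ : Measure X} {h : ℝ → ℝ} {b : ℝ}
  [SecondCountableTopology X]

theorem integrable_of_mem_domMeasures {f : X → ℝ} (hf : LocallyIntegrable f μ)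
    {ν : Measure X} (hν : ν ∈ DomMeasures μ) : Integrable f ν :=
  (show Integrable f (μ.restrict ν.support) from hf.integrableOn_isCompact hν.2).mono_measure
    (le_restrict_of_null_compl hν.1 Measure.measure_compl_support)

variable [BorelSpace X]

/-- Some coupling moves almost no point farther than `r`. This confines all measures near a given
one to a common compact set. -/
theorem Close.null_compl_cthickening {δ r : ℝ} {ν η : Measure X} (hc : Close δ ν η) (hr : δ < r) :
    η (Metric.cthickening r ν.support)ᶜ = 0 := by
  obtain ⟨p, rfl, rfl, hp⟩ := hc r hr
  rw [Measure.snd_apply Metric.isClosed_cthickening.measurableSet.compl]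
  refine measure_mono_null (t := {z | r < dist z.1 z.2} ∪ Prod.fst ⁻¹' p.fst.supportᶜ) ?_
    (measure_union_null (le_antisymm hp zero_le) ?_)
  · intro z hz
    by_contra hcon
    simp only [mem_union, mem_ofPred_eq, mem_preimage, mem_compl_iff, not_or, not_lt,
      not_not] at hcon
    exact hz (Metric.mem_cthickening_of_dist_le _ _ _ _ hcon.2 (by rw [dist_comm]; exact hcon.1))
  · rw [← Measure.fst_apply Measure.isOpen_compl_support.measurableSet,
      Measure.measure_compl_support]

variable [LocallyCompactSpace X] [IsLocallyFiniteMeasure μ]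

/-- The integral of a locally integrable function is continuous along close measures, uniformly
near a given measure. -/
theorem exists_forall_close_abs_integral_sub_le {f : X → ℝ} (hf : LocallyIntegrable f μ)
    {η : Measure X} (hη : η ∈ DomMeasures μ) {τ : ℝ} (hτ : 0 < τ) :
    ∃ ε > 0, ∀ ζ ∈ DomMeasures μ, Close ε η ζ → |∫ x, f x ∂ζ - ∫ x, f x ∂η| ≤ τ := by
  have hfη := isFiniteMeasure_of_mem_domMeasures hη
  obtain ⟨r, hr, hK⟩ := hη.2.exists_isCompact_cthickening
  set K := Metric.cthickening r η.support
  have hfK : Integrable f (μ.restrict K) := hf.integrableOn_isCompact hK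
  -- Because `ζ ≤ μ`, an `L¹(μ)` approximation on `K` by a continuous `φ` is uniformly good for all
  -- `ζ` carried by `K`; for `φ` itself uniform continuity and a coupling suffice.
  obtain ⟨φ, hφc, hφf, hφ, hφi⟩ := hfK.exists_hasCompactSupport_integral_sub_le
    (show 0 < τ / 3 by linarith)
  have hM : 0 < η.real univ + 1 := by have := measureReal_nonneg (μ := η) (s := univ); linarith
  obtain ⟨ρ, hρ, hφρ⟩ := Metric.uniformContinuous_iff.1
    (hφc.uniformContinuous_of_continuous hφ) (τ / 3 / (η.real univ + 1)) (by positivity)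
  have happrox : ∀ ζ : Measure X, ζ ≤ μ.restrict K → |∫ x, f x ∂ζ - ∫ x, φ x ∂ζ| ≤ τ / 3 := by
    intro ζ hζ
    rw [← integral_sub (hfK.mono_measure hζ) (hφi.mono_measure hζ)]
    refine (abs_integral_le_integral_abs).trans (le_trans ?_ hφf)
    exact integral_mono_measure hζ (Eventually.of_forall fun _ => abs_nonneg _)
      (hfK.sub hφi).norm
  have hmin : 0 < min r ρ := lt_min hr hρ
  refine ⟨min r ρ / 2, by linarith, fun ζ hζ hc => ?_⟩
  have hζK : ζ Kᶜ = 0 :=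
    hc.null_compl_cthickening (by linarith [min_le_left r ρ])
  have hηK : η Kᶜ = 0 := measure_mono_null
    (compl_subset_compl.2 (Metric.self_subset_cthickening _)) Measure.measure_compl_support
  have h1 := happrox ζ (le_restrict_of_null_compl hζ.1 hζK)
  have h2 := happrox η (le_restrict_of_null_compl hη.1 hηK)
  have hφζ : Integrable φ ζ := hφi.mono_measure (le_restrict_of_null_compl hζ.1 hζK)
  have hφη : Integrable φ η := hφi.mono_measure (le_restrict_of_null_compl hη.1 hηK)
  have h3 : |∫ x, φ x ∂ζ - ∫ x, φ x ∂η| ≤ τ / 3 := by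
    obtain ⟨p, hp1, hp2, hp⟩ := hc (min r ρ * (3 / 4)) (by linarith)
    have hpf : IsFiniteMeasure p := ⟨by rw [← Measure.fst_univ, hp1]; exact measure_lt_top _ _⟩
    have e1 : ∫ x, φ x ∂ζ = ∫ z, φ z.2 ∂p := by
      rw [← hp2, Measure.snd, integral_map measurable_snd.aemeasurable
        hφ.aestronglyMeasurable]
    have e2 : ∫ x, φ x ∂η = ∫ z, φ z.1 ∂p := by
      rw [← hp1, Measure.fst, integral_map measurable_fst.aemeasurable
        hφ.aestronglyMeasurable]
    have i1 : Integrable (fun z : X × X => φ z.2) p := by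
      rw [← hp2] at hφζ
      exact hφζ.comp_measurable measurable_snd
    have i2 : Integrable (fun z : X × X => φ z.1) p := by
      rw [← hp1] at hφη
      exact hφη.comp_measurable measurable_fst
    rw [e1, e2, ← integral_sub i1 i2, ← Real.norm_eq_abs]
    have hae : ∀ᵐ z ∂p, ‖φ z.2 - φ z.1‖ ≤ τ / 3 / (η.real univ + 1) := by
      filter_upwards [measure_eq_zero_iff_ae_notMem.1 (le_antisymm hp zero_le)] with z hz
      replace hz := not_lt.1 hz
      rw [← dist_eq_norm]
      refine (hφρ ?_).le
      rw [dist_comm]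
      linarith [min_le_right r ρ]
    refine (norm_integral_le_of_norm_le_const hae).trans ?_
    have : p.real univ = η.real univ := by
      rw [Measure.real, Measure.real, ← hp1, Measure.fst_univ]
    rw [this, div_mul_eq_mul_div, div_le_iff₀ hM]
    nlinarith
  rw [abs_le] at *
  constructor <;> linarith

variable [StandardBorelSpace X] {ν : ℝ → NonzeroDom μ}

theorem IsCurve.continuousOn_integral (hh : IsGauge h) (hν : IsCurve μ h b ν) {f : X → ℝ}
    (hf : LocallyIntegrable f μ) : ContinuousOn (fun t => ∫ x, f x ∂(ν t).1) (Icc 0 b) := by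
  intro t ht
  rw [ContinuousWithinAt, Metric.tendsto_nhdsWithin_nhds]
  intro τ hτ
  obtain ⟨ε, hε, H⟩ := exists_forall_close_abs_integral_sub_le hf (ν t).2.1 (half_pos hτ)
  refine ⟨ε, hε, fun s hs hst => ?_⟩
  rw [Real.dist_eq] at hst ⊢
  refine (H _ (ν s).2.1 ?_).trans_lt (half_lt_self hτ)
  rcases le_total s t with hle | hle
  · exact ((hν.close hh hs.1 hle ht.2).symm).mono
      (by rw [abs_sub_comm, abs_of_nonneg (by linarith)] at hst; exact hst.le)
  · exact (hν.close hh ht.1 hle hs.2).mono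
      (by rw [abs_of_nonneg (by linarith)] at hst; exact hst.le)

end Integrals

/-! ### Initial growth, bounds along curves and slopes -/

/-- A continuous function whose lower right Dini derivative is at most the continuous function `G`
grows at most by the integral of `G`. -/
theorem sub_le_integral_of_liminf_slope_right_le {φ G : ℝ → ℝ} {b : ℝ}
    (hφ : ContinuousOn φ (Icc 0 b)) (hG : ContinuousOn G (Icc 0 b))
    (hb : ∀ x ∈ Ico 0 b, ∀ r, G x < r → ∃ᶠ z in 𝓝[>] x, slope φ x z < r) {s : ℝ}
    (hs : s ∈ Icc 0 b) : φ s - φ 0 ≤ ∫ t in (0 : ℝ)..s, G t := by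
  have h0b : 0 ≤ b := hs.1.trans hs.2
  set G' : ℝ → ℝ := IccExtend h0b ((Icc 0 b).domRestrict G) with hG'
  have hGc : Continuous G' := (continuousOn_iff_continuous_domRestrict.1 hG).Icc_extend'
  have hGG : ∀ x ∈ Icc 0 b, G' x = G x := fun x hx => by
    rw [hG', IccExtend_of_mem _ _ hx, domRestrict_apply]
  have hd : ∀ x, HasDerivAt (fun u => φ 0 + ∫ t in (0 : ℝ)..u, G' t) (G' x) x := fun x =>
    ((hGc.integral_hasStrictDerivAt 0 x).hasDerivAt).const_add _
  have := image_le_of_liminf_slope_right_le_deriv_boundary hφ (B' := G')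
    (B := fun u => φ 0 + ∫ t in (0 : ℝ)..u, G' t) (by simp)
    (fun x _ => (hd x).continuousAt.continuousWithinAt) (fun x _ => (hd x).hasDerivWithinAt)
    (fun x hx r hr => hb x hx r (by rwa [← hGG x ⟨hx.1, hx.2.le⟩])) hs
  have hcongr : ∫ t in (0 : ℝ)..s, G' t = ∫ t in (0 : ℝ)..s, G t := by
    refine intervalIntegral.integral_congr fun t ht => ?_
    rw [uIcc_of_le hs.1] at ht
    exact hGG t ⟨ht.1, ht.2.trans hs.2⟩
  simp only [hcongr] at this
  linarith

theorem integral_congr_of_le {α : Type*} [MeasurableSpace α] {μ ν : Measure α} {f f' : α → ℝ}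
    (hν : ν ≤ μ) (hf : f =ᵐ[μ] f') :
    ∫ x, f x ∂ν = ∫ x, f' x ∂ν :=
  integral_congr_ae (Measure.absolutelyContinuous_of_le hν hf)

section Bounds

variable {X : Type*} [MetricSpace X] [MeasurableSpace X] {μ : Measure X} {h : ℝ → ℝ} {b : ℝ}
  {f f' g g' : X → ℝ}

theorem BoundsAlongCurves.congr (H : BoundsAlongCurves μ h f g) (hf : f =ᵐ[μ] f')
    (hg : g =ᵐ[μ] g') : BoundsAlongCurves μ h f' g' where
  locallyIntegrable := H.locallyIntegrable.congr hf
  locallyIntegrable_grad := H.locallyIntegrable_grad.congr hg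
  nonneg := by filter_upwards [H.nonneg, hg] with x hx hx'; rwa [← hx']
  bound b ν hν s hs hsb := by
    have := H.bound b ν hν s hs hsb
    simp_rw [fun t => integral_congr_of_le (ν t).2.1.1 hf,
      fun t => integral_congr_of_le (ν t).2.1.1 hg] at this
    exact this

theorem BoundsAlongCurves.neg (H : BoundsAlongCurves μ h f g) :
    BoundsAlongCurves μ h (fun x => -f x) g where
  locallyIntegrable := H.locallyIntegrable.neg
  locallyIntegrable_grad := H.locallyIntegrable_grad
  nonneg := H.nonneg
  bound b ν hν s hs hsb := by
    simp_rw [integral_neg]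
    rw [← abs_neg, neg_sub, sub_neg_eq_add, neg_add_eq_sub]
    exact H.bound b ν hν s hs hsb

theorem IsUpperGradient.congr_grad (H : IsUpperGradient μ h f g) (hg : g =ᵐ[μ] g') :
    IsUpperGradient μ h f g' where
  locallyIntegrable := H.locallyIntegrable
  locallyIntegrable_grad := H.locallyIntegrable_grad.congr hg
  slope_eq η := by
    rw [H.slope_eq η, meanValue, meanValue, integral_congr_of_le η.2.1.1 hg]

theorem IsUpperGradient.meanValue_nonneg (H : IsUpperGradient μ h f g) (η : NonzeroDom μ) :
    0 ≤ meanValue μ g η := by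
  have := H.slope_eq η
  have h0 : (0 : EReal) ≤ ((meanValue μ g η : ℝ) : EReal) := by
    rw [← this]; exact EReal.coe_ennreal_nonneg _
  exact_mod_cast h0

theorem isUpperGradient_of_curveSlope_eq (hf : LocallyIntegrable f μ) (hg : LocallyIntegrable g μ)
    (H : ∀ η : NonzeroDom μ, 0 ≤ meanValue μ g η ∧
      curveSlope μ h (meanValue μ f) η = ENNReal.ofReal (meanValue μ g η)) :
    IsUpperGradient μ h f g where
  locallyIntegrable := hf
  locallyIntegrable_grad := hg
  slope_eq η := by
    rw [(H η).2, EReal.coe_ennreal_ofReal, max_eq_left (H η).1]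

theorem meanValue_sub_of_mass_eq {η ζ : NonzeroDom μ} (hm : ζ.1.real univ = η.1.real univ) :
    meanValue μ f ζ - meanValue μ f η =
      (η.1.real univ)⁻¹ * (∫ x, f x ∂ζ.1 - ∫ x, f x ∂η.1) := by
  rw [meanValue, meanValue, hm, mul_sub]

theorem curveSlopeAt_mono (F : NonzeroDom μ → ℝ) (η : NonzeroDom μ) {ε ε' : ℝ} (hε : ε ≤ ε') :
    curveSlopeAt μ h F ε η ≤ curveSlopeAt μ h F ε' η := by
  refine iSup_mono fun b => iSup_mono fun ν => iSup_mono fun hν => iSup_mono fun h0 =>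
    iSup_mono fun s => iSup_mono' fun hs => ⟨⟨hs.1, hs.2.trans_le (min_le_min hε le_rfl)⟩, le_rfl⟩

/-- The inequality is clear at a fixed scale; two different scales are replaced by their minimum,
using monotonicity in `ε`. -/
theorem curveSlope_le_add (F F₁ F₂ : NonzeroDom μ → ℝ) (η : NonzeroDom μ)
    (hF : ∀ ζ, |F ζ - F η| ≤ |F₁ ζ - F₁ η| + |F₂ ζ - F₂ η|) :
    curveSlope μ h F η ≤ curveSlope μ h F₁ η + curveSlope μ h F₂ η := by
  have hat : ∀ ε, curveSlopeAt μ h F ε η ≤ curveSlopeAt μ h F₁ ε η + curveSlopeAt μ h F₂ ε η := by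
    intro ε
    refine iSup_le fun b => iSup_le fun ν => iSup_le fun hν => iSup_le fun h0 =>
      iSup_le fun s => iSup_le fun hs => ?_
    have h1 : ∀ F' : NonzeroDom μ → ℝ,
        ENNReal.ofReal (|F' (ν s) - F' η| / s) ≤ curveSlopeAt μ h F' ε η := fun F' =>
      le_iSup_of_le b (le_iSup_of_le ν (le_iSup_of_le hν (le_iSup_of_le h0 (le_iSup_of_le s
        (le_iSup_of_le hs le_rfl)))))
    refine le_trans ?_ (add_le_add (h1 F₁) (h1 F₂))
    have hs0 := hs.1
    rw [← ENNReal.ofReal_add (by positivity) (by positivity), ← add_div]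
    exact ENNReal.ofReal_le_ofReal (div_le_div_of_nonneg_right (hF _) hs0.le)
  unfold curveSlope
  rw [ENNReal.iInf_add]
  refine le_iInf fun ε₁ => ?_
  rw [ENNReal.iInf_add]
  refine le_iInf fun h₁ => ?_
  rw [ENNReal.add_iInf]
  refine le_iInf fun ε₂ => ?_
  rw [ENNReal.add_iInf]
  refine le_iInf fun h₂ => ?_
  refine (iInf₂_le (min ε₁ ε₂) (lt_min h₁ h₂)).trans ((hat _).trans ?_)
  exact add_le_add (curveSlopeAt_mono _ _ (min_le_left _ _))
    (curveSlopeAt_mono _ _ (min_le_right _ _))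

theorem IsUpperGradient.curveSlope_eq (H : IsUpperGradient μ h f g) (η : NonzeroDom μ) :
    curveSlope μ h (meanValue μ f) η = ENNReal.ofReal (meanValue μ g η) := by
  have := H.slope_eq η
  rw [← EReal.coe_ennreal_eq_coe_ennreal_iff, this, EReal.coe_ennreal_ofReal,
    max_eq_left (H.meanValue_nonneg η)]

theorem BoundsAlongCurves.integral_nonneg (H : BoundsAlongCurves μ h f g) (η : NonzeroDom μ) :
    0 ≤ ∫ x, g x ∂η.1 :=
  integral_nonneg_of_ae (Measure.absolutelyContinuous_of_le η.2.1.1 H.nonneg)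

/-- Integrals against the measures in `𝓧` detect almost everywhere inequalities. -/
theorem ae_le_of_forall_integral_le [SecondCountableTopology X] [BorelSpace X]
    [LocallyCompactSpace X] (hf : LocallyIntegrable f μ) (hg : LocallyIntegrable g μ)
    (H : ∀ η : NonzeroDom μ, ∫ x, f x ∂η.1 ≤ ∫ x, g x ∂η.1) : f ≤ᵐ[μ] g := by
  have hcov : ∀ᵐ x ∂μ.restrict (⋃ n, compactCovering X n), f x ≤ g x := by
    rw [ae_restrict_iUnion_iff]
    intro n
    have hK := isCompact_compactCovering X n
    refine ae_le_of_forall_setIntegral_le (hf.integrableOn_isCompact hK)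
      (hg.integrableOn_isCompact hK) fun s hs _ => ?_
    rw [Measure.restrict_restrict hs]
    by_cases h0 : μ.restrict (s ∩ compactCovering X n) = 0
    · simp [h0]
    -- Restrictions of `μ` to subsets of a compact set are themselves test measures.
    · refine H ⟨_, ⟨Measure.restrict_le_self, hK.of_isClosed_subset Measure.isClosed_support ?_⟩,
        h0⟩
      refine Measure.support_subset_of_isClosed hK.isClosed ?_
      rw [mem_ae_iff, Measure.restrict_apply hK.isClosed.measurableSet.compl]
      exact measure_mono_null (t := ∅) (fun x hx => hx.1 hx.2.2) measure_empty
  rwa [iUnion_compactCovering, Measure.restrict_univ] at hcov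

theorem ae_eq_of_forall_integral_eq [SecondCountableTopology X] [BorelSpace X]
    [LocallyCompactSpace X] (hf : LocallyIntegrable f μ) (hg : LocallyIntegrable g μ)
    (H : ∀ η : NonzeroDom μ, ∫ x, f x ∂η.1 = ∫ x, g x ∂η.1) : f =ᵐ[μ] g :=
  (ae_le_of_forall_integral_le hf hg fun η => (H η).le).antisymm
    (ae_le_of_forall_integral_le hg hf fun η => (H η).ge)

variable [SecondCountableTopology X] [IsLocallyFiniteMeasure μ]

theorem BoundsAlongCurves.const (hh : IsGauge h) (c : ℝ) :
    BoundsAlongCurves μ h (fun _ => c) fun _ => 0 where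
  locallyIntegrable := locallyIntegrable_const c
  locallyIntegrable_grad := locallyIntegrable_const 0
  nonneg := Eventually.of_forall fun _ => le_rfl
  bound b ν hν s hs hsb := by
    simp [hν.mass_eq hh ⟨hs, hsb⟩]

theorem meanValue_nonneg_iff (η : NonzeroDom μ) : 0 ≤ meanValue μ g η ↔ 0 ≤ ∫ x, g x ∂η.1 :=
  mul_nonneg_iff_of_pos_left (inv_pos.2 η.mass_pos)

variable [BorelSpace X] [LocallyCompactSpace X]

theorem IsUpperGradient.nonneg_ae (H : IsUpperGradient μ h f g) : 0 ≤ᵐ[μ] g := by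
  refine ae_le_of_forall_integral_le (locallyIntegrable_const 0) H.locallyIntegrable_grad
    fun η => ?_
  simpa using (meanValue_nonneg_iff η).1 (H.meanValue_nonneg η)

theorem IsUpperGradient.ae_eq (H : IsUpperGradient μ h f g) (H' : IsUpperGradient μ h f g') :
    g =ᵐ[μ] g' := by
  refine ae_eq_of_forall_integral_eq H.locallyIntegrable_grad H'.locallyIntegrable_grad
    fun η => ?_
  have := (H.slope_eq η).symm.trans (H'.slope_eq η)
  rw [EReal.coe_eq_coe_iff] at this
  exact mul_left_cancel₀ (inv_ne_zero η.mass_pos.ne') this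

variable [StandardBorelSpace X]

/-- Bounds on the initial growth along all curves integrate to bounds along curves. -/
theorem boundsAlongCurves_of_eventually_le (hh : IsGauge h) (hf : LocallyIntegrable f μ)
    (hg : LocallyIntegrable g μ) (hg0 : 0 ≤ᵐ[μ] g)
    (H : ∀ (b : ℝ) (ν : ℝ → NonzeroDom μ), IsCurve μ h b ν → 0 < b → ∀ r, ∫ x, g x ∂(ν 0).1 < r →
      ∀ᶠ s in 𝓝[>] (0 : ℝ), ∫ x, f x ∂(ν s).1 - ∫ x, f x ∂(ν 0).1 ≤ r * s) :
    BoundsAlongCurves μ h f g := by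
  have hone : ∀ (b : ℝ) (ν : ℝ → NonzeroDom μ), IsCurve μ h b ν → ∀ s ∈ Icc 0 b,
      ∫ x, f x ∂(ν s).1 - ∫ x, f x ∂(ν 0).1 ≤ ∫ t in (0 : ℝ)..s, ∫ x, g x ∂(ν t).1 := by
    intro b ν hν s hs
    -- The hypothesis at time zero, applied to the curve restarted at `t`, controls the right slope
    -- at `t`.
    refine sub_le_integral_of_liminf_slope_right_le (φ := fun t => ∫ x, f x ∂(ν t).1)
      (hν.continuousOn_integral hh hf) (hν.continuousOn_integral hh hg) (fun t ht r hr => ?_) hs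
    have hr' : ∫ x, g x ∂(ν t).1 < (∫ x, g x ∂(ν t).1 + r) / 2 := by linarith
    have hev := H (b - t) _ (hν.shift ht.1 ht.2.le) (by linarith [ht.2])
      ((∫ x, g x ∂(ν t).1 + r) / 2) (by simpa using hr')
    have hshift : Tendsto (fun z => z - t) (𝓝[>] t) (𝓝[>] 0) := by
      refine tendsto_nhdsWithin_iff.2 ⟨?_, ?_⟩
      · have : Tendsto (fun z => z - t) (𝓝 t) (𝓝 (t - t)) := tendsto_id.sub_const t
        rw [sub_self] at this
        exact this.mono_left nhdsWithin_le_nhds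
      · filter_upwards [self_mem_nhdsWithin] with z hz
        exact sub_pos.2 (mem_Ioi.1 hz)
    refine Eventually.frequently ?_
    filter_upwards [hshift.eventually hev, self_mem_nhdsWithin] with z hz hzt
    have hzt : 0 < z - t := sub_pos.2 (mem_Ioi.1 hzt)
    rw [add_sub_cancel, add_zero] at hz
    rw [slope_def_field, div_lt_iff₀ hzt]
    nlinarith
  refine ⟨hf, hg, hg0, fun b ν hν s hs hsb => abs_le.2 ⟨?_, hone b ν hν s ⟨hs, hsb⟩⟩⟩
  -- The reversed curve exchanges the end points and leaves the integral of `g` unchanged, which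
  -- gives the opposite inequality.
  have := hone s _ (hν.reverse hs hsb) s ⟨hs, le_rfl⟩
  rw [intervalIntegral.integral_comp_sub_left (fun t => ∫ x, g x ∂(ν t).1) s] at this
  simp only [sub_self, sub_zero] at this
  linarith

/-- The slope at `ν 0` controls the initial growth of the mean value; constant mass turns mean
values into integrals by a fixed factor. -/
theorem IsUpperGradient.boundsAlongCurves (hh : IsGauge h) (H : IsUpperGradient μ h f g) :
    BoundsAlongCurves μ h f g := by
  refine boundsAlongCurves_of_eventually_le hh H.locallyIntegrable H.locallyIntegrable_grad
    H.nonneg_ae fun b ν hν hb r hr => ?_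
  have hm := (ν 0).mass_pos
  have hgr : meanValue μ g (ν 0) < ((ν 0).1.real univ)⁻¹ * r :=
    mul_lt_mul_of_pos_left hr (inv_pos.2 hm)
  have hlt : curveSlope μ h (meanValue μ f) (ν 0) <
      ENNReal.ofReal (((ν 0).1.real univ)⁻¹ * r) := by
    rw [H.curveSlope_eq]
    exact (ENNReal.ofReal_lt_ofReal_iff ((H.meanValue_nonneg _).trans_lt hgr)).2 hgr
  unfold curveSlope at hlt
  simp only [iInf_lt_iff] at hlt
  obtain ⟨ε, hε, hlt⟩ := hlt
  filter_upwards [Ioo_mem_nhdsGT (lt_min hε hb)] with s hs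
  have h1 : ENNReal.ofReal (|meanValue μ f (ν s) - meanValue μ f (ν 0)| / s) ≤
      curveSlopeAt μ h (meanValue μ f) ε (ν 0) :=
    le_iSup_of_le b (le_iSup_of_le ν (le_iSup_of_le hν (le_iSup_of_le rfl (le_iSup_of_le s
      (le_iSup_of_le hs le_rfl)))))
  have h2 := h1.trans_lt hlt
  rw [ENNReal.ofReal_lt_ofReal_iff ((H.meanValue_nonneg _).trans_lt hgr), div_lt_iff₀ hs.1,
    meanValue_sub_of_mass_eq (hν.mass_eq hh ⟨hs.1.le, hs.2.le.trans (min_le_right _ _)⟩), abs_mul,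
    abs_of_pos (inv_pos.2 hm), mul_assoc] at h2
  exact (le_abs_self _).trans (lt_of_mul_lt_mul_left h2 (inv_pos.2 hm).le).le

/-- The increment along a curve starting at `η` is at most `s (∫ g dη + τ)` for small `s`,
uniformly over all such curves. -/
theorem BoundsAlongCurves.exists_abs_integral_sub_le (hh : IsGauge h)
    (H : BoundsAlongCurves μ h f g) (η : NonzeroDom μ) {τ : ℝ} (hτ : 0 < τ) :
    ∃ ε > 0, ∀ (b : ℝ) (ν : ℝ → NonzeroDom μ), IsCurve μ h b ν → ν 0 = η → ∀ s, 0 ≤ s → s ≤ b →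
      s ≤ ε → |∫ x, f x ∂(ν s).1 - ∫ x, f x ∂η.1| ≤ (∫ x, g x ∂η.1 + τ) * s := by
  obtain ⟨ε, hε, hclose⟩ :=
    exists_forall_close_abs_integral_sub_le H.locallyIntegrable_grad η.2.1 hτ
  refine ⟨ε, hε, fun b ν hν h0 s hs hsb hsε => ?_⟩
  subst h0
  refine (H.bound b ν hν s hs hsb).trans ?_
  have hle : ∀ t ∈ Icc 0 s, ∫ x, g x ∂(ν t).1 ≤ ∫ x, g x ∂(ν 0).1 + τ := by
    intro t ht
    have hc := (hν.close hh le_rfl ht.1 (ht.2.trans hsb)).mono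
      (show t - 0 ≤ ε by linarith [ht.2])
    linarith [(abs_le.1 (hclose _ (ν t).2.1 hc)).2]
  have hint : IntervalIntegrable (fun t => ∫ x, g x ∂(ν t).1) volume 0 s := by
    refine ContinuousOn.intervalIntegrable ?_
    rw [uIcc_of_le hs]
    exact (hν.continuousOn_integral hh H.locallyIntegrable_grad).mono (Icc_subset_Icc le_rfl hsb)
  have := intervalIntegral.integral_mono_on hs hint intervalIntegrable_const hle
  rw [intervalIntegral.integral_const, smul_eq_mul, sub_zero, mul_comm] at this
  exact this

/-- Near `η` the integral of `g` exceeds `∫ g dη` by at most `τ`, uniformly over all curves from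
`η`; then let `τ → 0`. -/
theorem BoundsAlongCurves.curveSlope_le (hh : IsGauge h) (H : BoundsAlongCurves μ h f g)
    (η : NonzeroDom μ) : curveSlope μ h (meanValue μ f) η ≤ ENNReal.ofReal (meanValue μ g η) := by
  have hm := η.mass_pos
  have hτ : ∀ τ > 0, curveSlope μ h (meanValue μ f) η ≤
      ENNReal.ofReal ((η.1.real univ)⁻¹ * (∫ x, g x ∂η.1 + τ)) := by
    intro τ hτ
    obtain ⟨ε, hε, hb⟩ := H.exists_abs_integral_sub_le hh η hτ
    refine (iInf₂_le ε hε).trans ?_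
    refine iSup_le fun b => iSup_le fun ν => iSup_le fun hν => iSup_le fun h0 =>
      iSup_le fun s => iSup_le fun hs => ENNReal.ofReal_le_ofReal ?_
    have hsb : s ≤ b := hs.2.le.trans (min_le_right _ _)
    have hmass : (ν s).1.real univ = η.1.real univ := by
      rw [hν.mass_eq hh ⟨hs.1.le, hsb⟩, h0]
    rw [div_le_iff₀ hs.1, meanValue_sub_of_mass_eq hmass, abs_mul, abs_of_pos (inv_pos.2 hm),
      mul_assoc]
    exact mul_le_mul_of_nonneg_left (hb b ν hν h0 s hs.1.le hsb
      (hs.2.le.trans (min_le_left _ _))) (inv_pos.2 hm).le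
  have hlim : Tendsto (fun τ : ℝ => ENNReal.ofReal ((η.1.real univ)⁻¹ * (∫ x, g x ∂η.1 + τ)))
      (𝓝[>] 0) (𝓝 (ENNReal.ofReal (meanValue μ g η))) := by
    have hc : Continuous fun τ : ℝ =>
        ENNReal.ofReal ((η.1.real univ)⁻¹ * (∫ x, g x ∂η.1 + τ)) :=
      ENNReal.continuous_ofReal.comp (by fun_prop)
    have := (hc.tendsto 0).mono_left (nhdsWithin_le_nhds (s := Ioi 0))
    rwa [add_zero] at this
  refine ge_of_tendsto hlim ?_
  filter_upwards [self_mem_nhdsWithin] with τ hτ0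
  exact hτ τ hτ0

theorem BoundsAlongCurves.add (hh : IsGauge h) (H : BoundsAlongCurves μ h f g)
    (H' : BoundsAlongCurves μ h f' g') :
    BoundsAlongCurves μ h (fun x => f x + f' x) fun x => g x + g' x where
  locallyIntegrable := H.locallyIntegrable.add H'.locallyIntegrable
  locallyIntegrable_grad := H.locallyIntegrable_grad.add H'.locallyIntegrable_grad
  nonneg := by
    filter_upwards [H.nonneg, H'.nonneg] with x hx hx'
    exact add_nonneg hx hx'
  bound b ν hν s hs hsb := by
    have hint : ∀ u : X → ℝ, LocallyIntegrable u μ →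
        IntervalIntegrable (fun t => ∫ x, u x ∂(ν t).1) volume 0 s := fun u hu => by
      refine ContinuousOn.intervalIntegrable ?_
      rw [uIcc_of_le hs]
      exact (hν.continuousOn_integral hh hu).mono (Icc_subset_Icc le_rfl hsb)
    have hadd : ∀ {u v : X → ℝ}, LocallyIntegrable u μ → LocallyIntegrable v μ → ∀ t,
        ∫ x, u x + v x ∂(ν t).1 = ∫ x, u x ∂(ν t).1 + ∫ x, v x ∂(ν t).1 := fun hu hv t =>
      integral_add (integrable_of_mem_domMeasures hu (ν t).2.1)
        (integrable_of_mem_domMeasures hv (ν t).2.1)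
    simp_rw [hadd H.locallyIntegrable H'.locallyIntegrable,
      hadd H.locallyIntegrable_grad H'.locallyIntegrable_grad]
    rw [intervalIntegral.integral_add (hint g H.locallyIntegrable_grad)
      (hint g' H'.locallyIntegrable_grad), add_sub_add_comm]
    exact (abs_add_le _ _).trans (add_le_add (H.bound b ν hν s hs hsb) (H'.bound b ν hν s hs hsb))

end Bounds

/-! ### Truncation -/

theorem integral_min_le_of_le {X : Type*} [MeasurableSpace X] {k : X → ℝ} {ν a : Measure X}
    [IsFiniteMeasure ν] (ha : a ≤ ν)
    (hk : Integrable k ν) (c : ℝ) :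
    ∫ x, min (k x) c ∂ν ≤ ∫ x, k x ∂a + c * (ν.real univ - a.real univ) := by
  have hfa : IsFiniteMeasure a := isFiniteMeasure_of_le _ ha
  have hsub : ν - a + a = ν := Measure.sub_add_cancel_of_le ha
  have hle : ν - a ≤ ν := Measure.sub_le
  have hfs : IsFiniteMeasure (ν - a) := isFiniteMeasure_of_le _ hle
  have hmin : Integrable (fun x => min (k x) c) ν := hk.inf (integrable_const c)
  have hmass : (ν - a).real univ = ν.real univ - a.real univ := by
    rw [eq_sub_iff_add_eq, ← measureReal_add_apply, hsub]
  have h1 : ∫ x, min (k x) c ∂ν = ∫ x, min (k x) c ∂(ν - a) + ∫ x, min (k x) c ∂a := by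
    rw [← integral_add_measure (hmin.mono_measure hle) (hmin.mono_measure ha), hsub]
  have h2 : ∫ x, min (k x) c ∂(ν - a) ≤ c * (ν.real univ - a.real univ) := by
    rw [← hmass, mul_comm, ← smul_eq_mul, ← integral_const]
    exact integral_mono (hmin.mono_measure hle) (integrable_const c) fun x => min_le_right _ _
  have h3 : ∫ x, min (k x) c ∂a ≤ ∫ x, k x ∂a :=
    integral_mono (hmin.mono_measure ha) (hk.mono_measure ha) fun x => min_le_left _ _
  linarith

/-- The equality case of `integral_min_le_of_le`. It is used at time `0`, the inequality at time
`s`; in the difference the terms with `c` cancel because masses are constant. -/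
theorem integral_min_eq {X : Type*} [MeasurableSpace X] {k : X → ℝ} {ν : Measure X}
    [IsFiniteMeasure ν] (hk : Integrable k ν) {c : ℝ}
    (hS : MeasurableSet {x | k x < c}) :
    ∫ x, min (k x) c ∂ν = ∫ x, k x ∂ν.restrict {x | k x < c} +
      c * (ν.real univ - (ν.restrict {x | k x < c}).real univ) := by
  have hmin : Integrable (fun x => min (k x) c) ν := hk.inf (integrable_const c)
  rw [← integral_add_compl hS hmin]
  congr 1
  · exact setIntegral_congr_fun hS fun x hx => min_eq_left (le_of_lt hx)
  · have : ∫ x in {x | k x < c}ᶜ, min (k x) c ∂ν = ∫ _ in {x | k x < c}ᶜ, c ∂ν :=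
      setIntegral_congr_fun hS.compl fun x hx => min_eq_right (not_lt.1 hx)
    rw [this, setIntegral_const, smul_eq_mul, mul_comm, measureReal_compl hS,
      measureReal_restrict_apply MeasurableSet.univ, univ_inter]

theorem indicator_lt_add_indicator_gt_le {X : Type*} {k g : X → ℝ} (c : ℝ) {x : X}
    (hx : 0 ≤ g x) :
    {x | k x < c}.indicator g x + {x | c < k x}.indicator g x ≤ g x := by
  rcases lt_trichotomy (k x) c with hlt | heq | hgt
  · simp [indicator, hlt, hlt.not_gt]
  · simpa [indicator, heq] using hx
  · simp [indicator, hgt, hgt.not_gt]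

section Truncation

variable {X : Type*} [MetricSpace X] [MeasurableSpace X] {μ : Measure X} {h : ℝ → ℝ}
  {k g : X → ℝ}

theorem locallyIntegrable_min [IsLocallyFiniteMeasure μ] (hk : LocallyIntegrable k μ) (c : ℝ) :
    LocallyIntegrable (fun x => min (k x) c) μ := by
  intro x
  obtain ⟨s, hs, hks⟩ := hk x
  obtain ⟨t, ht, hct⟩ := locallyIntegrable_const (μ := μ) c x
  exact ⟨s ∩ t, inter_mem hs ht, (hks.mono_set inter_subset_left).inf
    (hct.mono_set inter_subset_right)⟩

variable [SecondCountableTopology X] [BorelSpace X] [LocallyCompactSpace X]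
  [IsLocallyFiniteMeasure μ] [StandardBorelSpace X]

/-- Following the part of the measure where `k < c` shows that truncation from above localizes
the bound. -/
theorem BoundsAlongCurves.min_of_measurable (hh : IsGauge h) (H : BoundsAlongCurves μ h k g)
    (hk : Measurable k) (c : ℝ) :
    BoundsAlongCurves μ h (fun x => min (k x) c) ({x | k x < c}.indicator g) := by
  have hS : MeasurableSet {x | k x < c} := measurableSet_lt hk measurable_const
  refine boundsAlongCurves_of_eventually_le hh (locallyIntegrable_min H.locallyIntegrable c)
    (H.locallyIntegrable_grad.indicator hS) ?_ fun b ν hν hb r hr => ?_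
  · filter_upwards [H.nonneg] with x hx
    exact indicator_apply_nonneg fun _ => hx
  rw [integral_indicator hS] at hr
  have hki : ∀ t, Integrable k (ν t).1 := fun t =>
    integrable_of_mem_domMeasures H.locallyIntegrable (ν t).2.1
  have h0 := integral_min_eq (hki 0) hS
  by_cases ha : (ν 0).1.restrict {x | k x < c} = 0
  · rw [ha, integral_zero_measure] at hr
    filter_upwards [Ioo_mem_nhdsGT hb] with s hs
    have h1 := integral_min_le_of_le (Measure.zero_le (ν s).1) (hki s) c
    rw [hν.mass_eq hh ⟨hs.1.le, hs.2.le⟩] at h1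
    rw [h0, ha]
    have := mul_pos hr hs.1
    simp only [integral_zero_measure] at h1 ⊢
    linarith
  · obtain ⟨a, haν, ha0, ham, hale⟩ := hν.exists_split hh Measure.restrict_le_self ha
    rw [← ha0] at hr
    -- This error makes the growth rate along `a` exactly `r`.
    obtain ⟨ε, hε, hbound⟩ := H.exists_abs_integral_sub_le hh (a 0)
      (show 0 < r - ∫ x, g x ∂(a 0).1 by linarith)
    filter_upwards [Ioo_mem_nhdsGT (lt_min hε hb)] with s hs
    have hsb : s ≤ b := hs.2.le.trans (min_le_right _ _)
    have h1 := integral_min_le_of_le (hale s ⟨hs.1.le, hsb⟩) (hki s) c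
    have h2 := (le_abs_self _).trans
      (hbound b a haν rfl s hs.1.le hsb (hs.2.le.trans (min_le_left _ _)))
    rw [hν.mass_eq hh ⟨hs.1.le, hsb⟩, Measure.real, Measure.real, ham] at h1
    rw [← ha0, Measure.real, Measure.real, ha0, ← ha0] at h0
    rw [add_sub_cancel] at h2
    rw [h0, ham]
    linarith

/-- A measurable representative of `k` suffices, since all measures involved are dominated by `μ`.
-/
theorem BoundsAlongCurves.min (hh : IsGauge h) (H : BoundsAlongCurves μ h k g) (c : ℝ) :
    BoundsAlongCurves μ h (fun x => min (k x) c) ({x | k x < c}.indicator g) := by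
  obtain ⟨k', hk', hkk⟩ := H.locallyIntegrable.aestronglyMeasurable
  refine ((H.congr hkk (ae_eq_refl g)).min_of_measurable hh hk'.measurable c).congr ?_ ?_
  · filter_upwards [hkk] with x hx
    rw [hx]
  · filter_upwards [hkk] with x hx
    simp only [indicator, mem_ofPred_eq, hx]

theorem BoundsAlongCurves.max (hh : IsGauge h) (H : BoundsAlongCurves μ h k g) (c : ℝ) :
    BoundsAlongCurves μ h (fun x => max (k x) c) ({x | c < k x}.indicator g) := by
  have := (H.neg.min hh (-c)).neg
  simpa only [min_neg_neg, neg_neg, neg_lt_neg_iff] using this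

/-- Bounds for the two truncations of `k` at `c` add up to a bound for `k`. -/
theorem BoundsAlongCurves.of_min_of_max (hh : IsGauge h) {c : ℝ} {u v : X → ℝ}
    (Hu : BoundsAlongCurves μ h (fun x => Min.min (k x) c) u)
    (Hv : BoundsAlongCurves μ h (fun x => Max.max (k x) c) v) :
    BoundsAlongCurves μ h k fun x => u x + v x := by
  have := (Hu.add hh Hv).add hh (BoundsAlongCurves.const hh (-c))
  simpa only [min_add_max, add_neg_cancel_right, add_zero] using this

/-- Both truncations are treated together: each slope is at most its candidate, and `key` gives the
reverse inequality for the sums. All terms are finite, so cancelling one leaves equality for the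
other. -/
theorem IsUpperGradient.min_and_max (hh : IsGauge h) (H : IsUpperGradient μ h k g) (c : ℝ) :
    IsUpperGradient μ h (fun x => Min.min (k x) c) ({x | k x < c}.indicator g) ∧
      IsUpperGradient μ h (fun x => Max.max (k x) c) ({x | c < k x}.indicator g) := by
  have hB := H.boundsAlongCurves hh
  have hmin := hB.min hh c
  have hmax := hB.max hh c
  have key : ∀ η : NonzeroDom μ,
      0 ≤ meanValue μ ({x | k x < c}.indicator g) η ∧
      0 ≤ meanValue μ ({x | c < k x}.indicator g) η ∧
      ENNReal.ofReal (meanValue μ ({x | k x < c}.indicator g) η) +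
        ENNReal.ofReal (meanValue μ ({x | c < k x}.indicator g) η) ≤
      curveSlope μ h (meanValue μ fun x => Min.min (k x) c) η +
        curveSlope μ h (meanValue μ fun x => Max.max (k x) c) η := by
    intro η
    have p1 := (meanValue_nonneg_iff η).2 (hmin.integral_nonneg η)
    have p2 := (meanValue_nonneg_iff η).2 (hmax.integral_nonneg η)
    refine ⟨p1, p2, ?_⟩
    have hle : meanValue μ ({x | k x < c}.indicator g) η +
        meanValue μ ({x | c < k x}.indicator g) η ≤ meanValue μ g η := by
      rw [meanValue, meanValue, meanValue, ← mul_add]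
      refine mul_le_mul_of_nonneg_left ?_ (inv_pos.2 η.mass_pos).le
      have i1 := integrable_of_mem_domMeasures hmin.locallyIntegrable_grad η.2.1
      have i2 := integrable_of_mem_domMeasures hmax.locallyIntegrable_grad η.2.1
      rw [← integral_add i1 i2]
      refine integral_mono_ae (i1.add i2)
        (integrable_of_mem_domMeasures H.locallyIntegrable_grad η.2.1) ?_
      filter_upwards [Measure.absolutelyContinuous_of_le η.2.1.1 H.nonneg_ae] with x hx
      exact indicator_lt_add_indicator_gt_le c hx
    rw [← ENNReal.ofReal_add p1 p2]
    refine (ENNReal.ofReal_le_ofReal hle).trans ?_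
    rw [← H.curveSlope_eq η]
    refine curveSlope_le_add _ _ _ η fun ζ => ?_
    have hF : ∀ ζ : NonzeroDom μ, meanValue μ k ζ =
        meanValue μ (fun x => Min.min (k x) c) ζ + meanValue μ (fun x => Max.max (k x) c) ζ - c := by
      intro ζ
      have i1 := integrable_of_mem_domMeasures hmin.locallyIntegrable ζ.2.1
      have i2 := integrable_of_mem_domMeasures hmax.locallyIntegrable ζ.2.1
      have i3 := integrable_of_mem_domMeasures H.locallyIntegrable ζ.2.1
      have hsum : ∫ x, Min.min (k x) c ∂ζ.1 + ∫ x, Max.max (k x) c ∂ζ.1 =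
          ∫ x, k x ∂ζ.1 + ζ.1.real univ * c := by
        rw [← integral_add i1 i2]
        simp_rw [min_add_max]
        rw [integral_add i3 (integrable_const c), integral_const, smul_eq_mul]
      rw [meanValue, meanValue, meanValue, ← mul_add, hsum, mul_add, ← mul_assoc,
        inv_mul_cancel₀ ζ.mass_pos.ne', one_mul, add_sub_cancel_right]
    rw [hF ζ, hF η]
    refine le_trans (le_of_eq ?_) (abs_add_le _ _)
    congr 1
    ring
  refine ⟨isUpperGradient_of_curveSlope_eq hmin.locallyIntegrable hmin.locallyIntegrable_grad
    fun η => ⟨(key η).1, le_antisymm (hmin.curveSlope_le hh η) ?_⟩,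
    isUpperGradient_of_curveSlope_eq hmax.locallyIntegrable hmax.locallyIntegrable_grad
    fun η => ⟨(key η).2.1, le_antisymm (hmax.curveSlope_le hh η) ?_⟩⟩
  · exact (ENNReal.add_le_add_iff_right ENNReal.ofReal_ne_top).1
      ((key η).2.2.trans (add_le_add le_rfl (hmax.curveSlope_le hh η)))
  · exact (ENNReal.add_le_add_iff_left ENNReal.ofReal_ne_top).1
      ((key η).2.2.trans (add_le_add (hmin.curveSlope_le hh η) le_rfl))

/-- Adding the bound for `max k c` to a competitor `g'` bounds `k`, so `g ≤ g' + g χ_{k>c}`. Where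
`k < c` the last term vanishes; elsewhere `g' ≥ 0` is enough. -/
theorem IsSmallestBound.min (hh : IsGauge h) (H : IsSmallestBound μ h k g) (c : ℝ) :
    IsSmallestBound μ h (fun x => Min.min (k x) c) ({x | k x < c}.indicator g) := by
  refine ⟨H.bounds.min hh c, fun g' hg' => ?_⟩
  filter_upwards [H.le _ (hg'.of_min_of_max hh (H.bounds.max hh c)), hg'.nonneg] with x hx hx0
  rcases lt_or_ge (k x) c with hlt | hge
  · simpa [indicator, hlt, hlt.not_gt] using hx
  · simpa [indicator, hge.not_gt] using hx0

theorem IsSmallestBound.max (hh : IsGauge h) (H : IsSmallestBound μ h k g) (c : ℝ) :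
    IsSmallestBound μ h (fun x => Max.max (k x) c) ({x | c < k x}.indicator g) := by
  refine ⟨H.bounds.max hh c, fun g' hg' => ?_⟩
  filter_upwards [H.le _ ((H.bounds.min hh c).of_min_of_max hh hg'), hg'.nonneg] with x hx hx0
  rcases lt_or_ge c (k x) with hlt | hge
  · simpa [indicator, hlt, hlt.not_gt] using hx
  · simpa [indicator, hge.not_gt] using hx0

end Truncation

/-! ### Uniqueness and conclusion -/

theorem isUpperGradient_iff_ae_eq {X : Type*} [MetricSpace X] [MeasurableSpace X]
    [SecondCountableTopology X] [BorelSpace X] [LocallyCompactSpace X] {μ : Measure X}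
    [IsLocallyFiniteMeasure μ] {h : ℝ → ℝ} {f u : X → ℝ} (H : IsUpperGradient μ h f u)
    (w : X → ℝ) : IsUpperGradient μ h f w ↔ w =ᵐ[μ] u :=
  ⟨fun hw => hw.ae_eq H, fun hw => H.congr_grad hw.symm⟩

theorem isSmallestBound_iff_ae_eq {X : Type*} [MetricSpace X] [MeasurableSpace X]
    {μ : Measure X} {h : ℝ → ℝ} {f u : X → ℝ} (H : IsSmallestBound μ h f u) (w : X → ℝ) :
    IsSmallestBound μ h f w ↔ w =ᵐ[μ] u := by
  refine ⟨fun hw => (hw.le u H.bounds).antisymm (H.le w hw.bounds), fun hw =>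
    ⟨H.bounds.congr (ae_eq_refl f) hw.symm, fun g' hg' => ?_⟩⟩
  exact hw.le.trans (H.le g' hg')

end MeasureCurves

theorem mainTheorem4 {X : Type*} [MetricSpace X] [LocallyCompactSpace X]
    [TopologicalSpace.SeparableSpace X] [MeasurableSpace X] [BorelSpace X]
    (μ : Measure X)
    (hμ : ∀ (x : X) (r : ℝ), 0 < r → 0 < μ (Metric.ball x r) ∧ μ (Metric.ball x r) < ∞)
    (h : ℝ → ℝ) (hh : MeasureCurves.IsGauge h) (k g : X → ℝ) (c : ℝ) :
    (MeasureCurves.IsUpperGradient μ h k g →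
      (∀ w : X → ℝ, MeasureCurves.IsUpperGradient μ h (fun x => min (k x) c) w ↔
        w =ᵐ[μ] {x | k x < c}.indicator g) ∧
      (∀ w : X → ℝ, MeasureCurves.IsUpperGradient μ h (fun x => max (k x) c) w ↔
        w =ᵐ[μ] {x | c < k x}.indicator g)) ∧
    (MeasureCurves.IsSmallestBound μ h k g →
      (∀ w : X → ℝ, MeasureCurves.IsSmallestBound μ h (fun x => min (k x) c) w ↔
        w =ᵐ[μ] {x | k x < c}.indicator g) ∧
      (∀ w : X → ℝ, MeasureCurves.IsSmallestBound μ h (fun x => max (k x) c) w ↔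
        w =ᵐ[μ] {x | c < k x}.indicator g)) := by
  have : SecondCountableTopology X := UniformSpace.secondCountable_of_separable X
  have : PolishSpace X := MeasureCurves.polishSpace_of_locallyCompact X
  have : IsLocallyFiniteMeasure μ :=
    ⟨fun x => ⟨Metric.ball x 1, Metric.ball_mem_nhds x one_pos, (hμ x 1 one_pos).2⟩⟩
  refine ⟨fun H => ?_, fun H => ?_⟩
  · have hH := H.min_and_max hh c
    exact ⟨MeasureCurves.isUpperGradient_iff_ae_eq hH.1,
      MeasureCurves.isUpperGradient_iff_ae_eq hH.2⟩
  · exact ⟨MeasureCurves.isSmallestBound_iff_ae_eq (H.min hh c),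
      MeasureCurves.isSmallestBound_iff_ae_eq (H.max hh c)⟩
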